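/- Let $d\ge 2$ and $\nu\ge 1$ be integers, and let $\mathcal G$ be the simple graph with vertex set $\mathbb Z^d\times\mathbb Z_\nu$ (where $\mathbb Z_\nu=\mathbb Z/\nu\mathbb Z$) obtained from $\mathbb Z^d$ by attaching a cyclic graph of order $\nu$ at every vertex: $(n,0)$ and $(n',0)$ are adjacent whenever $\|n-n'\|_1=1$, and for every $n\in\mathbb Z^d$ and $j\in\mathbb Z_\nu$ the vertex $(n,j)$ is adjacent to $(n,j+1)$ and to $(n,j-1)$; there are no loops and no multiple edges (so nothing is attached if $\nu=1$, and a single edge is attached if $\nu=2$). Let $A$ be the adjacency operator of $\mathcal G$. Let $q=(q_1,\dots,q_d)$ be a vector of positive integers with $\gcd(q_1,\dots,q_d)=1$, and let $V:\mathbb Z^d\times\mathbb Z_\nu\to\mathbb C$ be a $q$-periodic potential, that is, $V(n+l\odot q,j)=V(n,j)$ for all $n,l\in\mathbb Z^d$ and $j\in\mathbb Z_\nu$, where $l\odot q=(l_1q_1,\dots,l_dq_d)$; it acts by multiplication. Let $W=\{w\in\mathbb Z^d: 0\le w_i<q_i \text{ for all } i\}$. For $z\in(\mathbb C\setminus\{0\})^d$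 let $H(z)$ be the Floquet matrix of $A+V$, that is, the matrix indexed by $W\times\mathbb Z_\nu$ that represents the restriction of $A+V$ to $W\times\mathbb Z_\nu$ under the boundary conditions $u(n+l\odot q,j)=z^l u(n,j)$ ($n,l\in\mathbb Z^d$, $j\in\mathbb Z_\nu$), where $z^l=z_1^{l_1}\cdots z_d^{l_d}$. For $\lambda\in\mathbb C$ put $\mathcal P(z;\lambda)=\det(H(z)-\lambda I)$, a Laurent polynomial in $z_1,\dots,z_d$, and call $\{z\in(\mathbb C\setminus\{0\})^d:\mathcal P(z;\lambda)=0\}$ the Fermi variety of $A+V$ at energy $\lambda$. Then the Fermi variety of $A+V$ is irreducible for all but finitely many $\lambda\in\mathbb C$. More precisely, for all but finitely many $\lambda$, the polynomial $\mathcal P(\,\cdot\,;\lambda)$ is irreducible in $\mathbb C[z_1^{\pm1},\dots,z_d^{\pm1}]$, and its zero set in $(\mathbb C\setminus\{0\})^d$ is nonempty and is not contained in the union of two algebraic subsets of $(\mathbb C\setminus\{0\})^d$ unless it is contained in one of them. -/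

import Mathlib

namespace DecoratedLattice

/-- The vertices of the decorated lattice: `(n, j)` is the `j`-th vertex of the `ν`-cycle attached
at `n ∈ ℤ^d`; the vertex `(n, 0)` is the lattice point `n` itself. -/
abbrev Vertex (d ν : ℕ) : Type := (Fin d → ℤ) × ZMod ν

/-- The graph obtained from `ℤ^d` by attaching a cyclic graph of order `ν` at each vertex:
`(n, 0)` and `(n', 0)` are joined when `‖n - n'‖₁ = 1`, and `(n, j)` is joined to `(n, j + 1)` and
`(n, j - 1)`. It is a simple graph: there are no loops (for `ν = 1` nothing is attached) and no
multiple edges (for `ν = 2` a single edge is attached). -/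
def graph (d ν : ℕ) : SimpleGraph (Vertex d ν) where
  Adj x y := x ≠ y ∧
    ((x.2 = 0 ∧ y.2 = 0 ∧ ∑ i, |x.1 i - y.1 i| = 1) ∨
      (x.1 = y.1 ∧ (y.2 = x.2 + 1 ∨ y.2 = x.2 - 1)))
  symm := ⟨by
    rintro x y ⟨hne, h⟩
    refine ⟨hne.symm, ?_⟩
    rcases h with ⟨hx, hy, h⟩ | ⟨h, h' | h'⟩
    · exact Or.inl ⟨hy, hx, by simpa only [abs_sub_comm] using h⟩
    · exact Or.inr ⟨h.symm, Or.inr (by rw [h']; ring)⟩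
    · exact Or.inr ⟨h.symm, Or.inl (by rw [h']; ring)⟩⟩
  loopless := ⟨fun _ h => h.1 rfl⟩

open Classical in
/-- The matrix of the Schrödinger operator `A + V` in the standard basis of `ℓ²` of the vertex set:
`A` is the adjacency operator of the decorated lattice, `V` acts by multiplication. -/
noncomputable def hamiltonian (d ν : ℕ) (V : Vertex d ν → ℂ) :
    Matrix (Vertex d ν) (Vertex d ν) ℂ :=
  (graph d ν).adjMatrix ℂ + Matrix.diagonal V

/-- The translation of a vertex by `l ⊙ q = (l₁ q₁, …, l_d q_d)`. -/
def translate {d ν : ℕ} (q : Fin d → ℕ) (l : Fin d → ℤ) (x : Vertex d ν) : Vertex d ν :=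
  (fun i => x.1 i + l i * (q i : ℤ), x.2)

/-- `q`-periodicity of a potential: `V (n + l ⊙ q, j) = V (n, j)`. -/
def IsPeriodic {d ν : ℕ} (q : Fin d → ℕ) (V : Vertex d ν → ℂ) : Prop :=
  ∀ (l : Fin d → ℤ) (x : Vertex d ν), V (translate q l x) = V x

/-- The indices of the vertices of the fundamental domain `W × ℤ/ν`, where
`W = {w ∈ ℤ^d : 0 ≤ w_i < q_i}`. -/
abbrev Cell {d : ℕ} (ν : ℕ) (q : Fin d → ℕ) : Type := ((i : Fin d) → Fin (q i)) × ZMod ν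

/-- The vertex of the graph with a given index in the fundamental domain. -/
def Cell.toVertex {d ν : ℕ} {q : Fin d → ℕ} (a : Cell ν q) : Vertex d ν :=
  (fun i => ((a.1 i : ℕ) : ℤ), a.2)

/-- Laurent polynomials in `d` variables over `ℂ`: the monomial `z^α` with `α ∈ ℤ^d` is
`AddMonoidAlgebra.single α 1`. -/
abbrev LaurentPoly (d : ℕ) : Type := AddMonoidAlgebra ℂ (Fin d → ℤ)

/-- Each matrix entry of the Floquet matrix below is a finite sum. -/
theorem finite_support_hamiltonian {d ν : ℕ} (V : Vertex d ν → ℂ) {q : Fin d → ℕ}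
    (hq : ∀ i, 0 < q i) (x y : Vertex d ν) :
    {l : Fin d → ℤ | hamiltonian d ν V x (translate q l y) ≠ 0}.Finite := by
  have hsub : {l : Fin d → ℤ | hamiltonian d ν V x (translate q l y) ≠ 0} ⊆
      (fun (l : Fin d → ℤ) (i : Fin d) => y.1 i + l i * (q i : ℤ)) ⁻¹'
        Set.Icc (fun i => x.1 i - 1) (fun i => x.1 i + 1) := by
    intro l hl
    have key : ∀ i, |x.1 i - (y.1 i + l i * (q i : ℤ))| ≤ 1 := by
      by_contra! hcon
      obtain ⟨i, hi⟩ := hcon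
      apply hl
      have h1 : x.1 ≠ (translate q l y).1 := by
        intro h
        have h2 : x.1 i = y.1 i + l i * (q i : ℤ) := congrFun h i
        rw [h2] at hi
        simp at hi
      have hadj : ¬ (graph d ν).Adj x (translate q l y) := by
        rintro ⟨-, ⟨-, -, h⟩ | ⟨h, -⟩⟩
        · have := Finset.single_le_sum
            (f := fun i => |x.1 i - (translate q l y).1 i|)
            (fun i _ => abs_nonneg _) (Finset.mem_univ i)
          have h3 : |x.1 i - (y.1 i + l i * (q i : ℤ))| ≤ 1 := h ▸ this
          omega
        · exact h1 h
      have hne : x ≠ translate q l y := fun h => h1 (congrArg Prod.fst h)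
      simp [hamiltonian, SimpleGraph.adjMatrix_apply, hadj, Matrix.diagonal_apply_ne _ hne]
    constructor
    · intro i
      have := abs_le.1 (key i)
      simp only
      linarith [this.2]
    · intro i
      have := abs_le.1 (key i)
      simp only
      linarith [this.1]
  refine Set.Finite.subset (Set.Finite.preimage ?_ (Set.finite_Icc _ _)) hsub
  intro l _ l' _ h
  funext i
  have h2 : y.1 i + l i * (q i : ℤ) = y.1 i + l' i * (q i : ℤ) := congrFun h i
  have h3 : (q i : ℤ) ≠ 0 := by exact_mod_cast (hq i).ne'
  exact mul_right_cancel₀ h3 (by linarith)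

/-- The Floquet matrix: the restriction of `A + V` to the fundamental domain with the boundary
conditions `u (n + l ⊙ q, j) = z^l u (n, j)`, whose entries are Laurent polynomials in the Floquet
multipliers `z = (z₁, …, z_d)`. -/
noncomputable def floquetMatrix {d ν : ℕ} (q : Fin d → ℕ) (V : Vertex d ν → ℂ) :
    Matrix (Cell ν q) (Cell ν q) (LaurentPoly d) :=
  Matrix.of fun a b => ∑ᶠ l : Fin d → ℤ,
    AddMonoidAlgebra.single l (hamiltonian d ν V a.toVertex (translate q l b.toVertex))

/-- The dispersion polynomial at energy `lam`: the Laurent polynomial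
`P(z; lam) = det (H(z) - lam I)`, where `H(z)` is the Floquet matrix. -/
noncomputable def dispersion {d ν : ℕ} [NeZero ν] (q : Fin d → ℕ) (V : Vertex d ν → ℂ) (lam : ℂ) :
    LaurentPoly d :=
  (floquetMatrix q V - Matrix.scalar (Cell ν q) (algebraMap ℂ (LaurentPoly d) lam)).det

/-- The value of a Laurent polynomial at a point of `(ℂ \ {0})^d`. -/
noncomputable def evalAt {d : ℕ} (z : Fin d → ℂˣ) (f : LaurentPoly d) : ℂ :=
  f.coeff.sum fun α c => c * ∏ i, (z i : ℂ) ^ (α i)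

/-- The common zeros in `(ℂ \ {0})^d` of a set of Laurent polynomials. -/
def zeroLocus {d : ℕ} (T : Set (LaurentPoly d)) : Set (Fin d → ℂˣ) :=
  {z | ∀ f ∈ T, evalAt z f = 0}

/-- The Fermi variety of `A + V` at energy `lam`, in terms of the Floquet multipliers (that is,
modulo periodicity). -/
noncomputable def fermiVariety {d ν : ℕ} [NeZero ν] (q : Fin d → ℕ) (V : Vertex d ν → ℂ)
    (lam : ℂ) : Set (Fin d → ℂˣ) :=
  zeroLocus {dispersion q V lam}

/-- A subset of `(ℂ \ {0})^d` is irreducible if it is nonempty and is not covered by two algebraic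
subsets unless it is contained in one of them. -/
def IsIrreducibleVariety {d : ℕ} (S : Set (Fin d → ℂˣ)) : Prop :=
  S.Nonempty ∧ ∀ T₁ T₂ : Set (LaurentPoly d),
    S ⊆ zeroLocus T₁ ∪ zeroLocus T₂ → S ⊆ zeroLocus T₁ ∨ S ⊆ zeroLocus T₂

end DecoratedLattice

/-! Substitute `z_i = x_i ^ q_i` and conjugate by the monomials `x^w`. Hopping between lattice
points then depends only on displacements, and everything inside the decorations becomes a constant
matrix. If `lam` is not an eigenvalue of the block of decorating vertices, a Schur complement
removes them. A Fourier transform on `W` then diagonalizes the hopping. Up to a nonzero constant,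
`P` becomes the determinant of a constant matrix plus the diagonal matrix of the symbols `∑ i, (ρ_i
x_i + (ρ_i x_i)⁻¹)`, where `ρ` runs over tuples of `q_i`-th roots of unity.

The Newton polytope of this determinant is `|W|` times the cross-polytope. Its vertices carry
monomials, and the facet with signs `s` carries the product over `ρ` of the linear forms `∑ i, (ρ_i
x_i) ^ s_i`. These forms are prime, and pairwise non-associated because the `q_i` have gcd 1. The
substitutions `x ↦ ρ x` carry the form with `ρ = 1` to all the others. A factor of `P` in the
variables `z` is invariant under these substitutions, so on each facet one of two complementary
factors has a monomial as leading form (`isUnit_or_isUnit_of_mul_eq_prod_linearForm`).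

The combinatorics of the cross-polytope pass from facets to the whole factor
(`isUnit_or_isUnit_of_leadingForms`). For `d ≥ 3`, a factor that collapses on one facet collapses
everywhere. For `d = 2` the square is also a sum of two segments; then the facet form would divide
`P`, so `P` would vanish wherever `∑ i, x_i = 0`. A point `y` with `∑ i, y_i = 0` at which `P` is
nonzero rules this out, and such a `y`, fixed in advance, fails for only finitely many `lam`.
Irreducibility of the zero set follows from the Nullstellensatz in the torus. -/

namespace DecoratedLattice

open AddMonoidAlgebra (single)

/-! ### Evaluation of Laurent polynomials -/

/-- Evaluation of Laurent polynomials at a point of the torus, as an algebra homomorphism. -/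
noncomputable def evalHom {d : ℕ} (z : Fin d → ℂˣ) : LaurentPoly d →ₐ[ℂ] ℂ :=
  AddMonoidAlgebra.lift ℂ ℂ (Fin d → ℤ)
    { toFun := fun α => ∏ i, (z i : ℂ) ^ (α.toAdd i)
      map_one' := by simp
      map_mul' := fun α β => by
        simp only [toAdd_mul, Pi.add_apply, ← Finset.prod_mul_distrib]
        exact Finset.prod_congr rfl fun i _ => zpow_add₀ (z i).ne_zero _ _ }

theorem evalAt_eq_evalHom {d : ℕ} (z : Fin d → ℂˣ) (f : LaurentPoly d) :
    evalAt z f = evalHom z f := by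
  rw [evalHom, AddMonoidAlgebra.lift_apply]
  rfl

theorem evalHom_single {d : ℕ} (z : Fin d → ℂˣ) (α : Fin d → ℤ) (c : ℂ) :
    evalHom z (single α c) = c * ∏ i, (z i : ℂ) ^ (α i) := by
  rw [evalHom, AddMonoidAlgebra.lift_single]
  rfl

/-! ### Units -/

theorem isUnit_single {d : ℕ} (α : Fin d → ℤ) {c : ℂ} (hc : c ≠ 0) :
    IsUnit (single α c : LaurentPoly d) :=
  IsUnit.of_mul_eq_one (single (-α) c⁻¹) (by
    rw [AddMonoidAlgebra.single_mul_single, add_neg_cancel, mul_inv_cancel₀ hc,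
      AddMonoidAlgebra.one_def])

theorem exists_eq_single_of_card_support_eq_one {d : ℕ} {f : LaurentPoly d}
    (h : f.coeff.support.card = 1) : ∃ α c, c ≠ 0 ∧ f = single α c := by
  obtain ⟨α, hα⟩ := Finset.card_eq_one.1 h
  obtain ⟨h1, h2⟩ := Finsupp.support_eq_singleton.1 hα
  refine ⟨α, f.coeff α, h1, ?_⟩
  ext1
  rw [AddMonoidAlgebra.coeff_single]
  exact h2

/-- `ℤ^d` has the two unique sums property: if a factor of `1` had two exponents, two distinct pairs
of exponents would give uniquely represented sums. Both sums survive in the product, so both equal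
`0`, which contradicts uniqueness. -/
theorem isUnit_iff {d : ℕ} {f : LaurentPoly d} :
    IsUnit f ↔ ∃ α c, c ≠ 0 ∧ f = single α c := by
  constructor
  · rintro hf
    obtain ⟨g, hfg⟩ := hf.exists_right_inv
    have hf0 : f ≠ 0 := hf.ne_zero
    have hg0 : g ≠ 0 := by rintro rfl; simp at hfg
    apply exists_eq_single_of_card_support_eq_one
    by_contra hcard
    have hfc : 0 < f.coeff.support.card := by
      rw [Finset.card_pos, Finsupp.support_nonempty_iff]
      simpa using hf0
    have hgc : 0 < g.coeff.support.card := by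
      rw [Finset.card_pos, Finsupp.support_nonempty_iff]
      simpa using hg0
    obtain ⟨p₁, hp₁, p₂, hp₂, hne, hu₁, hu₂⟩ :=
      TwoUniqueSums.uniqueAdd_of_one_lt_card (A := f.coeff.support) (B := g.coeff.support)
        (lt_of_lt_of_le (by omega : 1 < f.coeff.support.card) (Nat.le_mul_of_pos_right _ hgc))
    rw [Finset.mem_product] at hp₁ hp₂
    have key : ∀ p : (Fin d → ℤ) × (Fin d → ℤ), p.1 ∈ f.coeff.support → p.2 ∈ g.coeff.support →
        UniqueAdd f.coeff.support g.coeff.support p.1 p.2 → p.1 + p.2 = 0 := by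
      intro p h1 h2 hu
      have h3 := AddMonoidAlgebra.coeff_mul_add_of_uniqueAdd hu
      by_contra h4
      rw [hfg, AddMonoidAlgebra.one_def, AddMonoidAlgebra.coeff_single,
        Finsupp.single_eq_of_ne h4] at h3
      exact mul_ne_zero (Finsupp.mem_support_iff.1 h1) (Finsupp.mem_support_iff.1 h2) h3.symm
    have h1 := key p₁ hp₁.1 hp₁.2 hu₁
    have h2 := key p₂ hp₂.1 hp₂.2 hu₂
    obtain ⟨h3, h4⟩ := hu₁ hp₂.1 hp₂.2 (h2.trans h1.symm)
    exact hne (Prod.ext h3.symm h4.symm)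
  · rintro ⟨α, c, hc, rfl⟩
    exact isUnit_single α hc

/-! ### Laurent polynomials as a localization of polynomials -/

/-- Exponent vectors of polynomials as exponent vectors of Laurent polynomials. -/
def natExponent (d : ℕ) : (Fin d →₀ ℕ) →+ (Fin d → ℤ) where
  toFun α i := (α i : ℤ)
  map_zero' := by ext; simp
  map_add' α β := by ext; simp

theorem natExponent_injective (d : ℕ) : Function.Injective (natExponent d) := by
  intro α β h
  ext i
  exact Int.ofNat_inj.1 (congrFun h i)

/-- The inclusion of polynomials into Laurent polynomials. -/
noncomputable def toLaurent (d : ℕ) : MvPolynomial (Fin d) ℂ →ₐ[ℂ] LaurentPoly d :=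
  AddMonoidAlgebra.mapDomainAlgHom ℂ ℂ (natExponent d)

theorem toLaurent_monomial {d : ℕ} (α : Fin d →₀ ℕ) (c : ℂ) :
    toLaurent d (MvPolynomial.monomial α c) = single (natExponent d α) c :=
  AddMonoidAlgebra.mapDomain_single

theorem toLaurent_injective (d : ℕ) : Function.Injective (toLaurent d) :=
  AddMonoidAlgebra.mapDomain_injective (natExponent_injective d)

theorem toLaurent_X {d : ℕ} (i : Fin d) :
    toLaurent d (MvPolynomial.X i) = single (Pi.single i 1) 1 := by
  rw [MvPolynomial.X, toLaurent_monomial]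
  congr 1
  ext j
  simp only [natExponent, AddMonoidHom.coe_mk, ZeroHom.coe_mk, Finsupp.single_apply,
    Pi.single_apply, eq_comm (a := i)]
  split_ifs <;> simp

theorem evalHom_toLaurent {d : ℕ} (z : Fin d → ℂˣ) (p : MvPolynomial (Fin d) ℂ) :
    evalHom z (toLaurent d p) = MvPolynomial.aeval (fun i => (z i : ℂ)) p := by
  have : (evalHom z).comp (toLaurent d) = MvPolynomial.aeval (fun i => (z i : ℂ)) := by
    apply MvPolynomial.algHom_ext
    intro i
    rw [AlgHom.comp_apply, toLaurent_X, evalHom_single, MvPolynomial.aeval_X, one_mul,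
      Finset.prod_eq_single i]
    · simp
    · intro j _ hj
      simp [hj]
    · simp
  rw [← this]
  rfl

noncomputable instance (d : ℕ) : Algebra (MvPolynomial (Fin d) ℂ) (LaurentPoly d) :=
  (toLaurent d).toRingHom.toAlgebra

/-- The monic monomials. -/
noncomputable def monomials (d : ℕ) : Submonoid (MvPolynomial (Fin d) ℂ) where
  carrier := Set.range fun α => MvPolynomial.monomial α 1
  one_mem' := ⟨0, rfl⟩
  mul_mem' := by
    rintro _ _ ⟨α, rfl⟩ ⟨β, rfl⟩
    exact ⟨α + β, by simp [MvPolynomial.monomial_mul]⟩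

theorem isUnit_toLaurent_of_mem_monomials {d : ℕ} {p : MvPolynomial (Fin d) ℂ}
    (hp : p ∈ monomials d) : IsUnit (toLaurent d p) := by
  obtain ⟨α, rfl⟩ := hp
  simp only [toLaurent_monomial]
  exact isUnit_single _ one_ne_zero

theorem exists_mul_toLaurent_eq {d : ℕ} (f : LaurentPoly d) :
    ∃ s ∈ monomials d, ∃ p, f * toLaurent d s = toLaurent d p := by
  induction f using AddMonoidAlgebra.induction_linear with
  | zero => exact ⟨1, one_mem _, 0, by simp⟩
  | add f g hf hg =>
    obtain ⟨s, hs, p, hp⟩ := hf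
    obtain ⟨t, ht, r, hr⟩ := hg
    refine ⟨s * t, mul_mem hs ht, p * t + r * s, ?_⟩
    rw [map_mul, map_add, map_mul, map_mul, ← hp, ← hr]
    ring
  | single α c =>
    refine ⟨_, ⟨Finsupp.equivFunOnFinite.symm fun i => (-α i).toNat, rfl⟩,
      MvPolynomial.monomial (Finsupp.equivFunOnFinite.symm fun i => (α i).toNat) c, ?_⟩
    simp only [toLaurent_monomial, AddMonoidAlgebra.single_mul_single, mul_one]
    congr 1
    ext i
    simp [natExponent]
    omega

instance (d : ℕ) : IsLocalization (monomials d) (LaurentPoly d) where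
  map_units s := isUnit_toLaurent_of_mem_monomials s.2
  surj f := by
    obtain ⟨s, hs, p, hp⟩ := exists_mul_toLaurent_eq f
    exact ⟨(p, ⟨s, hs⟩), hp⟩
  exists_of_eq h := ⟨1, by rw [toLaurent_injective d h]⟩

instance (d : ℕ) : UniqueFactorizationMonoid (LaurentPoly d) :=
  UniqueFactorizationMonoid.of_isLocalization (monomials d) (LaurentPoly d)

theorem prime_toLaurent {d : ℕ} {p : MvPolynomial (Fin d) ℂ} (hp : Irreducible p)
    (hu : ¬ IsUnit (toLaurent d p)) : Prime (toLaurent d p) :=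
  (IsLocalization.toLocalizationMap (monomials d) (LaurentPoly d)).map_prime hp.prime
    (fun h => hp.ne_zero (toLaurent_injective d (h.trans (map_zero _).symm))) hu

/-! ### The Nullstellensatz in the torus -/

/-- After clearing denominators this is the affine Nullstellensatz, where the monomials introduced
are units in the Laurent ring. -/
theorem exists_dvd_pow_of_vanishing {d : ℕ} (P f : LaurentPoly d)
    (h : ∀ z : Fin d → ℂˣ, evalHom z P = 0 → evalHom z f = 0) : ∃ N, P ∣ f ^ N := by
  obtain ⟨s, hs, p, hp⟩ := exists_mul_toLaurent_eq P
  obtain ⟨t, ht, g, hg⟩ := exists_mul_toLaurent_eq f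
  have hX : IsUnit (toLaurent d (∏ i, MvPolynomial.X i)) := by
    rw [map_prod, IsUnit.prod_iff]
    intro i _
    rw [toLaurent_X]
    exact isUnit_single _ one_ne_zero
  -- Nothing is known about `g` on the coordinate hyperplanes; the product of the variables forces
  -- vanishing there.
  have hmem : g * ∏ i, MvPolynomial.X i ∈
      MvPolynomial.vanishingIdeal ℂ (MvPolynomial.zeroLocus ℂ (Ideal.span {p})) := by
    rw [MvPolynomial.mem_vanishingIdeal_iff]
    intro x hx
    have hx0 : MvPolynomial.aeval x p = 0 :=
      MvPolynomial.mem_zeroLocus_iff.1 hx p (Ideal.mem_span_singleton_self p)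
    rw [map_mul, map_prod]
    by_cases h0 : ∀ i, x i ≠ 0
    · have hz : x = fun i => ((Units.mk0 (x i) (h0 i) : ℂˣ) : ℂ) := rfl
      have h1 : evalHom (fun i => Units.mk0 (x i) (h0 i)) P = 0 := by
        have h2 := congrArg (evalHom fun i => Units.mk0 (x i) (h0 i)) hp
        rw [map_mul, evalHom_toLaurent _ p, ← hz, hx0] at h2
        exact (mul_eq_zero.1 h2).resolve_right
          (((isUnit_toLaurent_of_mem_monomials hs).map _).ne_zero)
      have h3 := congrArg (evalHom fun i => Units.mk0 (x i) (h0 i)) hg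
      rw [map_mul, h _ h1, zero_mul, evalHom_toLaurent, ← hz] at h3
      rw [← h3, zero_mul]
    · push Not at h0
      obtain ⟨i, hi⟩ := h0
      rw [Finset.prod_eq_zero (Finset.mem_univ i) (by simpa using hi), mul_zero]
  rw [MvPolynomial.vanishingIdeal_zeroLocus_eq_radical] at hmem
  obtain ⟨N, hN⟩ := hmem
  rw [Ideal.mem_span_singleton] at hN
  refine ⟨N, ?_⟩
  have h1 := map_dvd (toLaurent d) hN
  rw [map_pow, map_mul, ← hp, ← hg, mul_pow, mul_pow,
    (hX.pow N).dvd_mul_right, ((isUnit_toLaurent_of_mem_monomials ht).pow N).dvd_mul_right] at h1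
  exact dvd_of_mul_right_dvd h1

/-- Irreducible elements are prime in this factorial ring. An empty zero set would make `P` divide
`1`. If neither algebraic set contained the zero set, `P` would divide a power of `f₁ * f₂` for some
`f₁`, `f₂` not vanishing on it. -/
theorem isIrreducibleVariety_of_irreducible {d : ℕ} {P : LaurentPoly d} (hP : Irreducible P) :
    IsIrreducibleVariety (zeroLocus {P}) := by
  have hmem : ∀ z, z ∈ zeroLocus {P} ↔ evalHom z P = 0 := by
    intro z
    simp [zeroLocus, evalAt_eq_evalHom]
  constructor
  · by_contra hne
    rw [Set.not_nonempty_iff_eq_empty] at hne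
    obtain ⟨N, hN⟩ := exists_dvd_pow_of_vanishing P 1 fun z hz => by
      have : z ∈ zeroLocus {P} := (hmem z).2 hz
      rw [hne] at this
      exact this.elim
    rw [one_pow] at hN
    exact hP.not_isUnit (isUnit_of_dvd_one hN)
  · intro T₁ T₂ hcov
    by_contra! hcon
    obtain ⟨h₁, h₂⟩ := hcon
    rw [Set.not_subset] at h₁ h₂
    obtain ⟨z₁, hz₁, hz₁'⟩ := h₁
    obtain ⟨z₂, hz₂, hz₂'⟩ := h₂
    simp only [zeroLocus, Set.mem_ofPred_eq, not_forall] at hz₁' hz₂'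
    obtain ⟨f₁, hf₁, hne₁⟩ := hz₁'
    obtain ⟨f₂, hf₂, hne₂⟩ := hz₂'
    obtain ⟨N, hN⟩ := exists_dvd_pow_of_vanishing P (f₁ * f₂) fun z hz => by
      rw [map_mul, ← evalAt_eq_evalHom, ← evalAt_eq_evalHom]
      rcases hcov ((hmem z).2 hz) with h | h
      · rw [h f₁ hf₁, zero_mul]
      · rw [h f₂ hf₂, mul_zero]
    have hvan : ∀ f : LaurentPoly d, P ∣ f → ∀ z ∈ zeroLocus {P}, evalAt z f = 0 := by
      rintro _ ⟨g, rfl⟩ z hz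
      rw [evalAt_eq_evalHom, map_mul, (hmem z).1 hz, zero_mul]
    rcases hP.prime.dvd_or_dvd (hP.prime.dvd_of_dvd_pow hN) with h | h
    · exact hne₁ (hvan _ h _ hz₁)
    · exact hne₂ (hvan _ h _ hz₂)

end DecoratedLattice

namespace DecoratedLattice

open AddMonoidAlgebra (single)
open Matrix hiding single

/-! ### Supports and leading forms of Laurent polynomials -/

/-- The Laurent polynomials all of whose exponents lie in `S`. -/
def supportedIn {d : ℕ} (S : Set (Fin d → ℤ)) : Submodule ℂ (LaurentPoly d) where
  carrier := {f | ∀ α, f.coeff α ≠ 0 → α ∈ S}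
  zero_mem' := by simp
  add_mem' := by
    intro f g hf hg α hα
    by_cases h : f.coeff α = 0
    · exact hg α fun h' => hα (by simp [h, h'])
    · exact hf α h
  smul_mem' := by
    intro c f hf α hα
    exact hf α fun h => hα (by simp [h])

theorem supportedIn_mono {d : ℕ} {S T : Set (Fin d → ℤ)} (h : S ⊆ T) :
    supportedIn S ≤ supportedIn T := fun _ hf α hα => h (hf α hα)

theorem single_mem_supportedIn {d : ℕ} {S : Set (Fin d → ℤ)} {α : Fin d → ℤ} (h : α ∈ S) (c : ℂ) :
    single α c ∈ supportedIn S := by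
  intro β hβ
  rw [AddMonoidAlgebra.coeff_single, Finsupp.single_apply] at hβ
  split_ifs at hβ with h'
  · exact h' ▸ h
  · exact absurd rfl hβ

theorem mul_mem_supportedIn {d : ℕ} {S T U : Set (Fin d → ℤ)} {f g : LaurentPoly d}
    (hf : f ∈ supportedIn S) (hg : g ∈ supportedIn T) (h : ∀ α ∈ S, ∀ β ∈ T, α + β ∈ U) :
    f * g ∈ supportedIn U := by
  classical
  intro γ hγ
  have := AddMonoidAlgebra.support_coeff_mul_subset f g (Finsupp.mem_support_iff.2 hγ)
  obtain ⟨α, hα, β, hβ, rfl⟩ := Finset.mem_add.1 this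
  exact h α (hf α (Finsupp.mem_support_iff.1 hα)) β (hg β (Finsupp.mem_support_iff.1 hβ))

/-- The Laurent polynomials that are homogeneous of weight `k` with respect to `t`. -/
abbrev homogeneous {d : ℕ} (t : Fin d → ℤ) (k : ℤ) : Submodule ℂ (LaurentPoly d) :=
  supportedIn {α | t ⬝ᵥ α = k}

/-- The Laurent polynomials of weight less than `k` with respect to `t`. -/
abbrev lowerThan {d : ℕ} (t : Fin d → ℤ) (k : ℤ) : Submodule ℂ (LaurentPoly d) :=
  supportedIn {α | t ⬝ᵥ α < k}

/-- The leading form of `F` with respect to the weight vector `t` is `f`, of weight `k`. -/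
def IsLeadingForm {d : ℕ} (t : Fin d → ℤ) (k : ℤ) (F f : LaurentPoly d) : Prop :=
  f ≠ 0 ∧ f ∈ homogeneous t k ∧ F - f ∈ lowerThan t k

theorem homogeneous_mul {d : ℕ} {t : Fin d → ℤ} {k l : ℤ} {f g : LaurentPoly d}
    (hf : f ∈ homogeneous t k) (hg : g ∈ homogeneous t l) : f * g ∈ homogeneous t (k + l) :=
  mul_mem_supportedIn hf hg fun α (hα : t ⬝ᵥ α = k) β (hβ : t ⬝ᵥ β = l) => by
    change t ⬝ᵥ (α + β) = k + l
    rw [dotProduct_add, hα, hβ]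

theorem homogeneous_mul_lowerThan {d : ℕ} {t : Fin d → ℤ} {k l : ℤ} {f g : LaurentPoly d}
    (hf : f ∈ homogeneous t k) (hg : g ∈ lowerThan t l) : f * g ∈ lowerThan t (k + l) :=
  mul_mem_supportedIn hf hg fun α (hα : t ⬝ᵥ α = k) β (hβ : t ⬝ᵥ β < l) => by
    change t ⬝ᵥ (α + β) < k + l
    rw [dotProduct_add]
    linarith

theorem lowerThan_mul {d : ℕ} {t : Fin d → ℤ} {k l : ℤ} {f g : LaurentPoly d}
    (hf : f ∈ lowerThan t k) (hg : g ∈ lowerThan t l) : f * g ∈ lowerThan t (k + l) :=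
  mul_mem_supportedIn hf hg fun α (hα : t ⬝ᵥ α < k) β (hβ : t ⬝ᵥ β < l) => by
    change t ⬝ᵥ (α + β) < k + l
    rw [dotProduct_add]
    linarith

namespace IsLeadingForm

variable {d : ℕ} {t : Fin d → ℤ} {k l : ℤ} {F G f g : LaurentPoly d}

theorem mul (hF : IsLeadingForm t k F f) (hG : IsLeadingForm t l G g) :
    IsLeadingForm t (k + l) (F * G) (f * g) := by
  refine ⟨mul_ne_zero hF.1 hG.1, homogeneous_mul hF.2.1 hG.2.1, ?_⟩
  have h : F * G - f * g = f * (G - g) + g * (F - f) + (F - f) * (G - g) := by ring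
  rw [h]
  exact add_mem (add_mem (homogeneous_mul_lowerThan hF.2.1 hG.2.2)
    (add_comm l k ▸ homogeneous_mul_lowerThan hG.2.1 hF.2.2)) (lowerThan_mul hF.2.2 hG.2.2)

theorem coeff_eq (hF : IsLeadingForm t k F f) {α : Fin d → ℤ} (hα : t ⬝ᵥ α = k) :
    f.coeff α = F.coeff α := by
  by_contra h
  have h1 : (F - f).coeff α ≠ 0 := by
    rw [AddMonoidAlgebra.coeff_sub, Finsupp.sub_apply]
    exact sub_ne_zero.2 (Ne.symm h)
  exact (hF.2.2 α h1 : t ⬝ᵥ α < k).ne hα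

theorem le (hF : IsLeadingForm t k F f) {α : Fin d → ℤ} (hα : F.coeff α ≠ 0) : t ⬝ᵥ α ≤ k := by
  by_contra! h
  have h1 : f.coeff α = 0 := by
    by_contra h1
    exact h.ne' (hF.2.1 α h1)
  have h2 : (F - f).coeff α ≠ 0 := by
    rwa [AddMonoidAlgebra.coeff_sub, Finsupp.sub_apply, h1, sub_zero]
  exact h.asymm (hF.2.2 α h2)

theorem exists_coeff_ne_zero (hF : IsLeadingForm t k F f) :
    ∃ α, f.coeff α ≠ 0 ∧ F.coeff α ≠ 0 ∧ t ⬝ᵥ α = k := by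
  obtain ⟨α, hα⟩ : ∃ α, f.coeff α ≠ 0 := by
    by_contra! h
    exact hF.1 (by ext α; simp [h α])
  have h1 : t ⬝ᵥ α = k := hF.2.1 α hα
  exact ⟨α, hα, hF.coeff_eq h1 ▸ hα, h1⟩

theorem weight_unique (hf : IsLeadingForm t k F f) (hg : IsLeadingForm t l F g) : k = l := by
  obtain ⟨α, -, hα, h⟩ := hf.exists_coeff_ne_zero
  obtain ⟨β, -, hβ, h'⟩ := hg.exists_coeff_ne_zero
  exact le_antisymm (h ▸ hg.le hα) (h' ▸ hf.le hβ)

theorem unique (hf : IsLeadingForm t k F f) (hg : IsLeadingForm t l F g) : f = g := by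
  obtain rfl := hf.weight_unique hg
  ext α
  by_cases h : t ⬝ᵥ α = k
  · rw [hf.coeff_eq h, hg.coeff_eq h]
  · rw [not_not.1 (mt (hf.2.1 α) h), not_not.1 (mt (hg.2.1 α) h)]

end IsLeadingForm

theorem exists_isLeadingForm {d : ℕ} (t : Fin d → ℤ) {F : LaurentPoly d} (hF : F ≠ 0) :
    ∃ k f, IsLeadingForm t k F f := by
  classical
  have hne : F.coeff.support.Nonempty := by
    rw [Finsupp.support_nonempty_iff]
    simpa using hF
  obtain ⟨β, hβ, hmax⟩ := Finset.exists_max_image F.coeff.support (fun α => t ⬝ᵥ α) hne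
  refine ⟨t ⬝ᵥ β, .ofCoeff (F.coeff.filter fun α => t ⬝ᵥ α = t ⬝ᵥ β), ?_, ?_, ?_⟩
  · intro h
    have h1 := congrArg (fun f : LaurentPoly d => f.coeff β) h
    simp only [AddMonoidAlgebra.coeff_zero, Finsupp.zero_apply] at h1
    exact Finsupp.mem_support_iff.1 hβ
      ((Finsupp.filter_apply_pos (fun α => t ⬝ᵥ α = t ⬝ᵥ β) _ rfl).symm.trans h1)
  · intro α hα
    by_contra h
    exact hα (Finsupp.filter_apply_neg _ _ h)
  · intro α hα
    rw [AddMonoidAlgebra.coeff_sub, Finsupp.sub_apply] at hα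
    by_cases h : t ⬝ᵥ α = t ⬝ᵥ β
    · exact absurd (sub_eq_zero.2 (Finsupp.filter_apply_pos (fun α => t ⬝ᵥ α = t ⬝ᵥ β) _ h).symm) hα
    · have h1 : (AddMonoidAlgebra.ofCoeff
          (F.coeff.filter fun α => t ⬝ᵥ α = t ⬝ᵥ β) : LaurentPoly d).coeff α = 0 :=
        Finsupp.filter_apply_neg _ _ h
      rw [h1, sub_zero] at hα
      exact lt_of_le_of_ne (hmax α (Finsupp.mem_support_iff.2 hα)) h

theorem prod_add_sub_prod_mem_lowerThan {d : ℕ} {ι : Type*} {t : Fin d → ℤ}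
    (s : Finset ι) (f r : ι → LaurentPoly d) (hf : ∀ i, f i ∈ homogeneous t 1)
    (hr : ∀ i, r i ∈ lowerThan t 1) :
    ∏ i ∈ s, f i ∈ homogeneous t s.card ∧
      ∏ i ∈ s, (f i + r i) - ∏ i ∈ s, f i ∈ lowerThan t s.card := by
  classical
  induction s using Finset.induction_on with
  | empty =>
    simp only [Finset.prod_empty, sub_self, zero_mem, and_true, Finset.card_empty]
    rw [AddMonoidAlgebra.one_def]
    exact single_mem_supportedIn (by simp) _
  | insert i s hi ih =>
    rw [Finset.prod_insert hi, Finset.prod_insert hi, Finset.card_insert_of_notMem hi,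
      Nat.cast_succ, add_comm _ (1 : ℤ)]
    refine ⟨homogeneous_mul (hf i) ih.1, ?_⟩
    have h : (f i + r i) * ∏ j ∈ s, (f j + r j) - f i * ∏ j ∈ s, f j =
        f i * (∏ j ∈ s, (f j + r j) - ∏ j ∈ s, f j) + (∏ j ∈ s, f j) * r i +
          r i * (∏ j ∈ s, (f j + r j) - ∏ j ∈ s, f j) := by ring
    rw [h]
    exact add_mem (add_mem (homogeneous_mul_lowerThan (hf i) ih.2)
      (add_comm _ (1 : ℤ) ▸ homogeneous_mul_lowerThan ih.1 (hr i))) (lowerThan_mul (hr i) ih.2)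

theorem det_add_sub_det_mem_lowerThan {d : ℕ} {ι : Type*} [Fintype ι] [DecidableEq ι]
    {t : Fin d → ℤ} (M R : Matrix ι ι (LaurentPoly d)) (hM : ∀ i j, M i j ∈ homogeneous t 1)
    (hR : ∀ i j, R i j ∈ lowerThan t 1) :
    M.det ∈ homogeneous t (Fintype.card ι) ∧
      (M + R).det - M.det ∈ lowerThan t (Fintype.card ι) := by
  have key := fun σ : Equiv.Perm ι => prod_add_sub_prod_mem_lowerThan (t := t) Finset.univ
    (fun i => M (σ i) i) (fun i => R (σ i) i) (fun i => hM _ _) (fun i => hR _ _)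
  have hsign : ∀ (S : Submodule ℂ (LaurentPoly d)) (u : ℤˣ) (f : LaurentPoly d), f ∈ S →
      u • f ∈ S := by
    intro S u f hf
    rcases Int.units_eq_one_or u with rfl | rfl
    · simpa using hf
    · simpa using hf
  constructor
  · rw [det_apply]
    exact sum_mem fun σ _ => hsign _ _ _ (key σ).1
  · rw [det_apply, det_apply, ← Finset.sum_sub_distrib]
    refine sum_mem fun σ _ => ?_
    rw [← smul_sub]
    exact hsign _ _ _ (key σ).2

/-- In the Leibniz expansion, any product that uses an entry of `R` loses weight, so only the
determinant of the diagonal part has top weight. -/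
theorem isLeadingForm_det_diagonal_add {d : ℕ} {ι : Type*} [Fintype ι] [DecidableEq ι]
    {t : Fin d → ℤ} (f : ι → LaurentPoly d) (R : Matrix ι ι (LaurentPoly d))
    (hf : ∀ i, f i ∈ homogeneous t 1) (hR : ∀ i j, R i j ∈ lowerThan t 1)
    (h0 : ∀ i, f i ≠ 0) :
    IsLeadingForm t (Fintype.card ι) (diagonal f + R).det (∏ i, f i) := by
  have h := det_add_sub_det_mem_lowerThan (t := t) (diagonal f) R (fun i j => by
    rw [diagonal_apply]
    split_ifs
    · exact hf i
    · exact zero_mem _) hR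
  rw [det_diagonal] at h
  exact ⟨Finset.prod_ne_zero_iff.2 fun i _ => h0 i, h⟩

end DecoratedLattice

namespace DecoratedLattice

open AddMonoidAlgebra (single)
open Matrix hiding single

/-! ### Newton polytopes of factors

The Newton polytope of `P` is a multiple of the cross-polytope; its facets are indexed by sign
vectors `s : Fin d → ℤˣ` and its vertices by `Fin d × ℤˣ`. -/

/-- The weight vector that exposes the facet of the cross-polytope with signs `s`. -/
def signWeight {d : ℕ} (s : Fin d → ℤˣ) : Fin d → ℤ := fun i => s i

/-- The weight vector that exposes the vertex `ε e_i` of the cross-polytope. -/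
def axisWeight {d : ℕ} (i : Fin d) (ε : ℤˣ) : Fin d → ℤ := Pi.single i (ε : ℤ)

theorem axisWeight_dotProduct {d : ℕ} (i : Fin d) (ε : ℤˣ) (α : Fin d → ℤ) :
    axisWeight i ε ⬝ᵥ α = ε * α i := by
  rw [axisWeight, single_dotProduct]

theorem signWeight_dotProduct_axisWeight {d : ℕ} (s : Fin d → ℤˣ) (i : Fin d) (ε : ℤˣ) :
    signWeight s ⬝ᵥ axisWeight i ε = s i * ε := by
  rw [axisWeight, dotProduct_single, signWeight]

theorem IsLeadingForm.exists_of_mul {d : ℕ} {t : Fin d → ℤ} {k : ℤ} {F G p : LaurentPoly d}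
    (hF : F ≠ 0) (hG : G ≠ 0) (h : IsLeadingForm t k (F * G) p) :
    ∃ l f m g, IsLeadingForm t l F f ∧ IsLeadingForm t m G g ∧ l + m = k ∧ f * g = p := by
  obtain ⟨l, f, hf⟩ := exists_isLeadingForm t hF
  obtain ⟨m, g, hg⟩ := exists_isLeadingForm t hG
  exact ⟨l, f, m, g, hf, hg, (hf.mul hg).weight_unique h, (hf.mul hg).unique h⟩

/-- A factor of a Laurent polynomial whose Newton polytope is a cross-polytope has the
vertices `a i ε` and its support is bounded by the supporting hyperplanes through them. -/
structure HasVertices {d : ℕ} (F : LaurentPoly d) (a : Fin d → ℤˣ → Fin d → ℤ) : Prop where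
  coeff_ne_zero : ∀ i ε, F.coeff (a i ε) ≠ 0
  axis_le : ∀ i (ε : ℤˣ) α, F.coeff α ≠ 0 → ε * α i ≤ ε * a i ε i
  sign_le : ∀ (s : Fin d → ℤˣ) i α, F.coeff α ≠ 0 → signWeight s ⬝ᵥ α ≤ signWeight s ⬝ᵥ a i (s i)

/-- In an axis direction the leading form of the product is a unit, so both factors have monomial
leading forms. Their exponents are the vertices, and they add up to the vertex of the big
cross-polytope. -/
theorem exists_hasVertices {d : ℕ} {F G : LaurentPoly d} {Q : ℤ} (hF : F ≠ 0) (hG : G ≠ 0)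
    (haxis : ∀ i ε, ∃ c, c ≠ 0 ∧
      IsLeadingForm (axisWeight i ε) Q (F * G) (single (Q • axisWeight i ε) c))
    (hsign : ∀ s, ∃ h, IsLeadingForm (signWeight s) Q (F * G) h) :
    ∃ a b, HasVertices F a ∧ HasVertices G b := by
  have key : ∀ i ε, ∃ α β, F.coeff α ≠ 0 ∧ G.coeff β ≠ 0 ∧ α + β = Q • axisWeight i ε ∧
      (∀ γ, F.coeff γ ≠ 0 → axisWeight i ε ⬝ᵥ γ ≤ axisWeight i ε ⬝ᵥ α) ∧
      (∀ γ, G.coeff γ ≠ 0 → axisWeight i ε ⬝ᵥ γ ≤ axisWeight i ε ⬝ᵥ β) := by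
    intro i ε
    obtain ⟨c, hc, h⟩ := haxis i ε
    obtain ⟨l, f, m, g, hf, hg, -, hfg⟩ := h.exists_of_mul hF hG
    have hu : IsUnit (f * g) := hfg ▸ isUnit_single _ hc
    obtain ⟨α, c₁, hc₁, rfl⟩ := isUnit_iff.1 (isUnit_of_mul_isUnit_left hu)
    obtain ⟨β, c₂, hc₂, rfl⟩ := isUnit_iff.1 (isUnit_of_mul_isUnit_right hu)
    have hα : axisWeight i ε ⬝ᵥ α = l := hf.2.1 α (by simpa using hc₁)
    have hβ : axisWeight i ε ⬝ᵥ β = m := hg.2.1 β (by simpa using hc₂)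
    refine ⟨α, β, ?_, ?_, ?_, fun γ hγ => hα ▸ hf.le hγ, fun γ hγ => hβ ▸ hg.le hγ⟩
    · rw [← hf.coeff_eq hα]
      simpa using hc₁
    · rw [← hg.coeff_eq hβ]
      simpa using hc₂
    · rw [AddMonoidAlgebra.single_mul_single, AddMonoidAlgebra.single_inj] at hfg
      rcases hfg with h | h
      · exact h.1
      · exact absurd h.2 hc
  choose a b ha hb hab hFa hGb using key
  -- The sum of the two vertices lies on the facet `s` and so has the maximal weight for the
  -- product. Taking one of `α`, `β` to be a vertex separates the inequality into one for each
  -- factor.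
  have hsum : ∀ (s : Fin d → ℤˣ) (i : Fin d) α β, F.coeff α ≠ 0 → G.coeff β ≠ 0 →
      signWeight s ⬝ᵥ α + signWeight s ⬝ᵥ β ≤
        signWeight s ⬝ᵥ a i (s i) + signWeight s ⬝ᵥ b i (s i) := by
    intro s i α β hα hβ
    obtain ⟨h, hh⟩ := hsign s
    obtain ⟨l, f, m, g, hf, hg, hlm, -⟩ := hh.exists_of_mul hF hG
    rw [← dotProduct_add _ (a i (s i)), hab, dotProduct_smul, signWeight_dotProduct_axisWeight,
      ← Units.val_mul, Int.units_mul_self, Units.val_one, smul_eq_mul, mul_one, ← hlm]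
    exact add_le_add (hf.le hα) (hg.le hβ)
  refine ⟨a, b, ⟨ha, ?_, ?_⟩, ⟨hb, ?_, ?_⟩⟩
  · intro i ε α hα
    simpa only [axisWeight_dotProduct] using hFa i ε α hα
  · intro s i α hα
    linarith [hsum s i α _ hα (hb i (s i))]
  · intro i ε α hα
    simpa only [axisWeight_dotProduct] using hGb i ε α hα
  · intro s i α hα
    linarith [hsum s i _ α (ha i (s i)) hα]

namespace HasVertices

variable {d : ℕ} {F : LaurentPoly d} {a : Fin d → ℤˣ → Fin d → ℤ}

theorem dotProduct_eq (hF : HasVertices F a) (s : Fin d → ℤˣ) (i j : Fin d) :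
    signWeight s ⬝ᵥ a i (s i) = signWeight s ⬝ᵥ a j (s j) :=
  le_antisymm (hF.sign_le s j _ (hF.coeff_ne_zero _ _)) (hF.sign_le s i _ (hF.coeff_ne_zero _ _))

/-- If a facet of a factor is a single point, then all vertices in this facet coincide. -/
theorem exists_eq_of_isUnit (hF : HasVertices F a) {s : Fin d → ℤˣ} {k : ℤ} {f : LaurentPoly d}
    (hf : IsLeadingForm (signWeight s) k F f) (hu : IsUnit f) :
    ∃ α c, f = single α c ∧ ∀ i, a i (s i) = α := by
  obtain ⟨α, c, hc, rfl⟩ := isUnit_iff.1 hu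
  refine ⟨α, c, rfl, fun i => ?_⟩
  have h1 : signWeight s ⬝ᵥ a i (s i) = k := by
    obtain ⟨β, -, hβ, hβk⟩ := hf.exists_coeff_ne_zero
    exact le_antisymm (hf.le (hF.coeff_ne_zero _ _)) (hβk ▸ hF.sign_le s i β hβ)
  have h2 := hf.coeff_eq h1
  by_contra h3
  rw [AddMonoidAlgebra.coeff_single, Finsupp.single_eq_of_ne h3] at h2
  exact hF.coeff_ne_zero _ _ h2.symm

/-- The bounds for `ε = 1` and `ε = -1` pin every coordinate of an exponent. -/
theorem isUnit_of_forall_eq [NeZero d] (hF : HasVertices F a) {α : Fin d → ℤ}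
    (h : ∀ i ε, a i ε i = α i) : IsUnit F := by
  have h1 : ∀ β, F.coeff β ≠ 0 → β = α := by
    intro β hβ
    ext i
    have h2 := hF.axis_le i 1 β hβ
    have h3 := hF.axis_le i (-1) β hβ
    rw [h] at h2 h3
    simp only [Units.val_one, one_mul, Units.val_neg, neg_mul] at h2 h3
    omega
  have h4 : F = single α (F.coeff α) := by
    ext β
    rw [AddMonoidAlgebra.coeff_single, Finsupp.single_apply]
    split_ifs with h5
    · rw [h5]
    · exact not_not.1 fun h6 => h5 (h1 β h6).symm
  rw [h4]
  refine isUnit_single _ fun h5 => ?_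
  rw [h5] at h4
  exact hF.coeff_ne_zero 0 1 (by rw [h4]; simp)

/-- The vertex `a i (-1)` lies on a common facet with some `a j 1 = α` for every `s` with `s i = -1`
and `s j = 1`. When `d ≥ 3` there are enough such `s` to force `a i (-1) = α`. -/
theorem isUnit_of_two_lt (hd : 2 < d) (hF : HasVertices F a) {α : Fin d → ℤ}
    (h : ∀ i, a i 1 = α) : IsUnit F := by
  have : NeZero d := ⟨by omega⟩
  have hcompl : ∀ i j : Fin d, ∃ k, k ≠ i ∧ k ≠ j := by
    intro i j
    have : ({i, j} : Finset (Fin d)).card < (Finset.univ : Finset (Fin d)).card := by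
      rw [Finset.card_fin]
      exact lt_of_le_of_lt Finset.card_le_two hd
    obtain ⟨k, -, hk⟩ := Finset.exists_mem_notMem_of_card_lt_card this
    simp only [Finset.mem_insert, Finset.mem_singleton, not_or] at hk
    exact ⟨k, hk⟩
  refine hF.isUnit_of_forall_eq (α := α) fun i ε => ?_
  rcases Int.units_eq_one_or ε with rfl | rfl
  · rw [h]
  have key : ∀ (s : Fin d → ℤˣ) (j : Fin d), s i = -1 → s j = 1 →
      signWeight s ⬝ᵥ (a i (-1) - α) = 0 := by
    intro s j hi hj
    have h1 := hF.dotProduct_eq s i j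
    rw [hi, hj, h] at h1
    rw [dotProduct_sub, h1, sub_self]
  obtain ⟨δ, hδ⟩ : ∃ δ, δ = a i (-1) - α := ⟨_, rfl⟩
  rw [← hδ] at key
  have hs1 : signWeight (Function.update 1 i (-1)) ⬝ᵥ δ = 0 := by
    obtain ⟨j, hj, -⟩ := hcompl i i
    exact key _ j (by simp) (by simp [hj])
  -- A third index `k` keeps a positive sign after the sign at `j` is flipped. The difference of the
  -- two weight vectors isolates coordinate `j`.
  have hzero : ∀ j, j ≠ i → δ j = 0 := by
    intro j hj
    obtain ⟨k, hki, hkj⟩ := hcompl i j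
    have h2 := key (Function.update (Function.update 1 i (-1)) j (-1)) k
      (by simp [hj.symm]) (by simp [hki, hkj])
    have h3 : signWeight (Function.update (1 : Fin d → ℤˣ) i (-1)) -
        signWeight (Function.update (Function.update 1 i (-1)) j (-1)) = Pi.single j 2 := by
      ext l
      simp only [signWeight, Pi.sub_apply]
      by_cases hl : l = j
      · subst hl
        simp [hj]
      · simp [hl]
    have h4 := congrArg (· ⬝ᵥ δ) h3
    simp only [sub_dotProduct, hs1, h2, single_dotProduct] at h4
    omega
  have h5 : signWeight (Function.update 1 i (-1)) ⬝ᵥ δ = -δ i := by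
    rw [dotProduct, Finset.sum_eq_single i]
    · simp [signWeight]
    · intro j _ hj
      rw [hzero j hj, mul_zero]
    · simp
  have h6 : δ i = 0 := by omega
  rw [hδ, Pi.sub_apply] at h6
  omega

end HasVertices

/-- If `F` collapses on two adjacent sides, three of its vertices agree, and the two remaining side
conditions determine the fourth. If instead `G` collapses on the adjacent side, one point attains
both its maximum and its minimum of the weight `(1, 1)`: the Newton polygon of `G` lies on a line.
-/
theorem HasVertices.isUnit_or_homogeneous {F G : LaurentPoly 2} {a b : Fin 2 → ℤˣ → Fin 2 → ℤ}
    (hF : HasVertices F a) (hG : HasVertices G b) {α : Fin 2 → ℤ} (h : ∀ i, a i 1 = α)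
    (hor : a 0 1 = a 1 (-1) ∨ b 0 1 = b 1 (-1)) :
    IsUnit F ∨ ∃ k, G ∈ homogeneous (signWeight 1) k := by
  rcases hor with h1 | h1
  · left
    have h2 := hF.dotProduct_eq ![-1, 1] 0 1
    have h3 := hF.dotProduct_eq ![-1, -1] 0 1
    simp only [signWeight, dotProduct, Fin.sum_univ_two, cons_val_zero, cons_val_one,
      Units.val_neg, Units.val_one, h, ← h1] at h2 h3
    refine hF.isUnit_of_forall_eq (α := α) fun i ε => ?_
    rcases Int.units_eq_one_or ε with rfl | rfl
    · rw [h]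
    · fin_cases i
      · change a 0 (-1) 0 = α 0
        omega
      · change a 1 (-1) 1 = α 1
        rw [← h1, h]
  · right
    refine ⟨signWeight 1 ⬝ᵥ b 0 1, fun β hβ => ?_⟩
    have h2 := hG.sign_le 1 0 β hβ
    have h3 := hG.sign_le (-1) 1 β hβ
    have h4 : signWeight (-1 : Fin 2 → ℤˣ) = -signWeight 1 := by
      ext i
      simp [signWeight]
    rw [h4, neg_dotProduct, neg_dotProduct, Pi.neg_apply, Pi.one_apply, ← h1] at h3
    rw [Pi.one_apply] at h2
    change _ = _
    omega

theorem HasVertices.isUnit_of_isUnit_leadingForm {d : ℕ} (hd : 2 ≤ d) {F G h : LaurentPoly d}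
    {Q : ℤ} {a b : Fin d → ℤˣ → Fin d → ℤ} (hF : HasVertices F a) (hG : HasVertices G b)
    (hh : IsLeadingForm (signWeight 1) Q (F * G) h)
    (hfacet : ∀ s k f l g, IsLeadingForm (signWeight s) k F f →
      IsLeadingForm (signWeight s) l G g → IsUnit f ∨ IsUnit g)
    (htwo : d = 2 → ¬ h ∣ F * G) {k : ℤ} {f : LaurentPoly d}
    (hf : IsLeadingForm (signWeight 1) k F f) (hu : IsUnit f) : IsUnit F := by
  obtain ⟨α, c, rfl, hα⟩ := hF.exists_eq_of_isUnit hf hu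
  rcases eq_or_lt_of_le hd with rfl | hd'
  · have hF0 : F ≠ 0 := fun h => hF.coeff_ne_zero 0 1 (by simp [h])
    have hG0 : G ≠ 0 := fun h => hG.coeff_ne_zero 0 1 (by simp [h])
    have hor : a 0 1 = a 1 (-1) ∨ b 0 1 = b 1 (-1) := by
      obtain ⟨k, f, hf⟩ := exists_isLeadingForm (signWeight ![1, -1]) hF0
      obtain ⟨l, g, hg⟩ := exists_isLeadingForm (signWeight ![1, -1]) hG0
      rcases hfacet _ k f l g hf hg with hu | hu
      · obtain ⟨β, _, _, hβ⟩ := hF.exists_eq_of_isUnit hf hu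
        exact Or.inl ((hβ 0).trans (hβ 1).symm)
      · obtain ⟨β, _, _, hβ⟩ := hG.exists_eq_of_isUnit hg hu
        exact Or.inr ((hβ 0).trans (hβ 1).symm)
    refine (hF.isUnit_or_homogeneous hG hα hor).resolve_right ?_
    rintro ⟨l, hl⟩
    -- A homogeneous `G` is its own leading form, so `h` is `G` times the unit leading form of `F`.
    have hG' : IsLeadingForm (signWeight 1) l G G := ⟨hG0, hl, by simp⟩
    refine htwo rfl ?_
    rw [← (hf.mul hG').unique hh]
    exact (hu.mul_left_dvd).2 (dvd_mul_left _ _)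
  · exact hF.isUnit_of_two_lt hd' hα

theorem isUnit_or_isUnit_of_leadingForms {d : ℕ} (hd : 2 ≤ d) {F G h : LaurentPoly d} {Q : ℤ}
    (haxis : ∀ i ε, ∃ c, c ≠ 0 ∧
      IsLeadingForm (axisWeight i ε) Q (F * G) (single (Q • axisWeight i ε) c))
    (hsign : ∀ s, ∃ h, IsLeadingForm (signWeight s) Q (F * G) h)
    (hh : IsLeadingForm (signWeight 1) Q (F * G) h)
    (hfacet : ∀ s k f l g, IsLeadingForm (signWeight s) k F f →
      IsLeadingForm (signWeight s) l G g → IsUnit f ∨ IsUnit g)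
    (htwo : d = 2 → ¬ h ∣ F * G) : IsUnit F ∨ IsUnit G := by
  have hFG : F * G ≠ 0 := by
    obtain ⟨α, -, hα, -⟩ := hh.exists_coeff_ne_zero
    intro h0
    simp [h0] at hα
  have hF0 := left_ne_zero_of_mul hFG
  have hG0 := right_ne_zero_of_mul hFG
  obtain ⟨a, b, ha, hb⟩ := exists_hasVertices hF0 hG0 haxis hsign
  obtain ⟨k, f, hf⟩ := exists_isLeadingForm (signWeight 1) hF0
  obtain ⟨l, g, hg⟩ := exists_isLeadingForm (signWeight 1) hG0
  rcases hfacet _ k f l g hf hg with hu | hu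
  · exact Or.inl (ha.isUnit_of_isUnit_leadingForm hd hb hh hfacet htwo hf hu)
  · rw [mul_comm] at hh htwo
    exact Or.inr (hb.isUnit_of_isUnit_leadingForm hd ha hh
      (fun s k f l g hf hg => (hfacet s l g k f hg hf).symm) htwo hg hu)

end DecoratedLattice

/-! ### Twists of the covering variables and the linear forms on the facets. -/

namespace DecoratedLattice

open AddMonoidAlgebra (single)
open scoped Matrix

/-! ### Monomial automorphisms of the ring of Laurent polynomials -/

/-- The substitution `x_i ↦ ρ_i x_i`. -/
noncomputable def twist {d : ℕ} (ρ : Fin d → ℂˣ) : LaurentPoly d →ₐ[ℂ] LaurentPoly d :=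
  AddMonoidAlgebra.lift ℂ _ (Fin d → ℤ)
    { toFun := fun α => single α.toAdd (∏ i, (ρ i : ℂ) ^ (α.toAdd i))
      map_one' := by simp [AddMonoidAlgebra.one_def]
      map_mul' := fun α β => by
        rw [AddMonoidAlgebra.single_mul_single, ← Finset.prod_mul_distrib]
        simp only [toAdd_mul, Pi.add_apply]
        congr 1
        exact Finset.prod_congr rfl fun i _ => zpow_add₀ (ρ i).ne_zero _ _ }

theorem twist_single {d : ℕ} (ρ : Fin d → ℂˣ) (α : Fin d → ℤ) (c : ℂ) :
    twist ρ (single α c) = single α (c * ∏ i, (ρ i : ℂ) ^ (α i)) := by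
  rw [twist, AddMonoidAlgebra.lift_single]
  change c • single α (∏ i, (ρ i : ℂ) ^ (α i)) = _
  rw [AddMonoidAlgebra.smul_single, smul_eq_mul]

theorem twist_eq_self {d : ℕ} {ρ : Fin d → ℂˣ} {f : LaurentPoly d}
    (h : f ∈ supportedIn {α | ∏ i, (ρ i : ℂ) ^ (α i) = 1}) : twist ρ f = f := by
  rw [twist, AddMonoidAlgebra.lift_apply]
  conv_rhs => rw [← AddMonoidAlgebra.sum_coeff_single f]
  refine Finset.sum_congr rfl fun α hα => ?_
  have h1 : ∏ i, (ρ i : ℂ) ^ (α i) = 1 := h α (Finsupp.mem_support_iff.1 hα)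
  change _ • single α (∏ i, (ρ i : ℂ) ^ (α i)) = _
  rw [h1, AddMonoidAlgebra.smul_single, smul_eq_mul, mul_one]

theorem twist_twist_inv {d : ℕ} (ρ : Fin d → ℂˣ) :
    (twist ρ).comp (twist ρ⁻¹) = AlgHom.id ℂ _ := by
  apply AddMonoidAlgebra.algHom_ext
  intro α
  rw [AlgHom.comp_apply, twist_single, twist_single, one_mul, ← Finset.prod_mul_distrib,
    Finset.prod_eq_one]
  · rfl
  · intro i _
    rw [← mul_zpow, Pi.inv_apply, Units.inv_mul, one_zpow]
  · exact Subsingleton.elim _ _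

/-- The substitution `x_i ↦ ρ_i x_i` as an automorphism. -/
noncomputable def twistEquiv {d : ℕ} (ρ : Fin d → ℂˣ) : LaurentPoly d ≃ₐ[ℂ] LaurentPoly d :=
  AlgEquiv.ofAlgHom (twist ρ) (twist ρ⁻¹) (twist_twist_inv ρ)
    (by simpa using twist_twist_inv ρ⁻¹)

/-- The substitution `x_i ↦ x_i ^ (s i)` for a sign vector `s`. -/
noncomputable def flip {d : ℕ} (s : Fin d → ℤˣ) : LaurentPoly d →ₐ[ℂ] LaurentPoly d :=
  AddMonoidAlgebra.mapDomainAlgHom ℂ ℂ (AddMonoidHom.mulLeft (signWeight s))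

theorem flip_single {d : ℕ} (s : Fin d → ℤˣ) (α : Fin d → ℤ) (c : ℂ) :
    flip s (single α c) = single (signWeight s * α) c :=
  AddMonoidAlgebra.mapDomain_single

theorem flip_flip {d : ℕ} (s : Fin d → ℤˣ) : (flip s).comp (flip s) = AlgHom.id ℂ _ := by
  apply AddMonoidAlgebra.algHom_ext
  intro α
  rw [AlgHom.comp_apply, flip_single, flip_single, ← mul_assoc]
  have : signWeight s * signWeight s = 1 := by
    ext i
    simp [signWeight, ← Units.val_mul]
  · rw [this, one_mul]
    rfl
  · exact Subsingleton.elim _ _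

/-- The substitution `x_i ↦ x_i ^ (s i)` as an automorphism. -/
noncomputable def flipEquiv {d : ℕ} (s : Fin d → ℤˣ) : LaurentPoly d ≃ₐ[ℂ] LaurentPoly d :=
  AlgEquiv.ofAlgHom (flip s) (flip s) (flip_flip s) (flip_flip s)

/-! ### Linear forms -/

/-- The linear form `∑ i, (ρ_i x_i) ^ (s i)`. -/
noncomputable def linearForm {d : ℕ} (ρ : Fin d → ℂˣ) (s : Fin d → ℤˣ) : LaurentPoly d :=
  ∑ i, single (axisWeight i (s i)) ((ρ i : ℂ) ^ (s i : ℤ))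

theorem prod_zpow_axisWeight {d : ℕ} (ρ : Fin d → ℂˣ) (i : Fin d) (ε : ℤˣ) :
    ∏ j, (ρ j : ℂ) ^ (axisWeight i ε j) = (ρ i : ℂ) ^ (ε : ℤ) := by
  rw [Finset.prod_eq_single i]
  · simp [axisWeight]
  · intro j _ hj
    simp [axisWeight, hj]
  · simp

theorem twist_linearForm_one {d : ℕ} (ρ : Fin d → ℂˣ) (s : Fin d → ℤˣ) :
    twist ρ (linearForm 1 s) = linearForm ρ s := by
  simp only [linearForm, map_sum, twist_single, prod_zpow_axisWeight, Pi.one_apply, Units.val_one,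
    one_zpow, one_mul]

theorem flip_linearForm_one {d : ℕ} (s : Fin d → ℤˣ) :
    flip s (linearForm 1 1) = linearForm 1 s := by
  simp only [linearForm, map_sum, flip_single, Pi.one_apply, Units.val_one, one_zpow]
  refine Finset.sum_congr rfl fun i _ => ?_
  congr 1
  ext j
  by_cases h : j = i
  · subst h
    simp [axisWeight, signWeight]
  · simp [axisWeight, h]

theorem evalHom_linearForm {d : ℕ} (x ρ : Fin d → ℂˣ) (s : Fin d → ℤˣ) :
    evalHom x (linearForm ρ s) = ∑ i, ((ρ i * x i : ℂˣ) : ℂ) ^ (s i : ℤ) := by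
  simp only [linearForm, map_sum, evalHom_single, prod_zpow_axisWeight, Units.val_mul, mul_zpow]

theorem linearForm_mem_homogeneous {d : ℕ} (ρ : Fin d → ℂˣ) (s : Fin d → ℤˣ) :
    linearForm ρ s ∈ homogeneous (signWeight s) 1 := by
  refine sum_mem fun i _ => single_mem_supportedIn ?_ _
  change signWeight s ⬝ᵥ axisWeight i (s i) = 1
  rw [signWeight_dotProduct_axisWeight, ← Units.val_mul, Int.units_mul_self, Units.val_one]

theorem exists_units_sum_eq_zero {d : ℕ} (hd : 2 ≤ d) : ∃ y : Fin d → ℂˣ, ∑ i, (y i : ℂ) = 0 := by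
  obtain ⟨m, rfl⟩ : ∃ m, d = m + 2 := ⟨d - 2, by omega⟩
  have h : -((m : ℂ) + 1) ≠ 0 := neg_ne_zero.2 (Nat.cast_add_one_ne_zero m)
  refine ⟨Fin.cons (Units.mk0 _ h) fun _ => 1, ?_⟩
  simp [Fin.sum_univ_succ]

/-- A linear form that vanishes on the torus points of the hyperplane `∑ i, y_i = 0` is a multiple
of `∑ i, y_i`. Compare its values at `y` and at `y + e (e_i - e_j)`. -/
theorem eq_of_forall_sum_eq_zero {d : ℕ} (hd : 2 ≤ d) (c : Fin d → ℂ)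
    (h : ∀ y : Fin d → ℂˣ, ∑ i, (y i : ℂ) = 0 → ∑ i, c i * y i = 0) (i j : Fin d) : c i = c j := by
  by_cases hij : i = j
  · rw [hij]
  obtain ⟨y, hy⟩ := exists_units_sum_eq_zero hd
  -- The excluded values keep the perturbation nonzero and the perturbed point in the torus.
  obtain ⟨e, he⟩ := Set.Finite.exists_notMem (Set.toFinite ({0, -(y i : ℂ), (y j : ℂ)} : Set ℂ))
  simp only [Set.mem_insert_iff, Set.mem_singleton_iff, not_or] at he
  obtain ⟨he0, hei, hej⟩ := he
  have h0 : ∀ k, (y k : ℂ) + (Pi.single i e - Pi.single j e : Fin d → ℂ) k ≠ 0 := by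
    intro k
    by_cases hki : k = i
    · subst hki
      rw [Pi.sub_apply, Pi.single_eq_same, Pi.single_eq_of_ne hij, sub_zero]
      exact fun h => hei (by linear_combination h)
    by_cases hkj : k = j
    · subst hkj
      rw [Pi.sub_apply, Pi.single_eq_same, Pi.single_eq_of_ne hki, zero_sub]
      exact fun h => hej (by linear_combination -h)
    rw [Pi.sub_apply, Pi.single_eq_of_ne hki, Pi.single_eq_of_ne hkj, sub_zero, add_zero]
    exact (y k).ne_zero
  have h1 := h (fun k => Units.mk0 _ (h0 k)) (by
    simp only [Units.val_mk0, Finset.sum_add_distrib, hy, Pi.sub_apply, Finset.sum_sub_distrib]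
    simp)
  simp only [Units.val_mk0, mul_add, Finset.sum_add_distrib, h y hy, Pi.sub_apply, mul_sub,
    Finset.sum_sub_distrib, zero_add, Pi.single_apply, mul_ite, mul_zero, Finset.sum_ite_eq',
    Finset.mem_univ, if_true] at h1
  rw [← sub_mul] at h1
  exact sub_eq_zero.1 ((mul_eq_zero.1 h1).resolve_right he0)

theorem zpow_unit_zpow_unit (x : ℂˣ) (ε : ℤˣ) : (x ^ (ε : ℤ)) ^ (ε : ℤ) = x := by
  rw [← zpow_mul, ← Units.val_mul, Int.units_mul_self, Units.val_one, zpow_one]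

/-- The zeros of `linearForm ρ s` are the points `x_i = y_i ^ s_i / ρ_i` with `∑ i, y_i = 0`. At
such a point the other form is linear in `y` with coefficients `(σ_i / ρ_i) ^ s_i`, which must
therefore all agree. -/
theorem div_zpow_eq_of_linearForm_dvd {d : ℕ} (hd : 2 ≤ d) {ρ σ : Fin d → ℂˣ} {s : Fin d → ℤˣ}
    (h : linearForm ρ s ∣ linearForm σ s) (i j : Fin d) :
    (σ i / ρ i) ^ (s i : ℤ) = (σ j / ρ j) ^ (s j : ℤ) := by
  have key := eq_of_forall_sum_eq_zero hd (fun i => (((σ i / ρ i) ^ (s i : ℤ) : ℂˣ) : ℂ))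
    (fun y hy => by
      obtain ⟨g, hg⟩ := h
      have h1 := congrArg (evalHom fun i => y i ^ (s i : ℤ) / ρ i) hg
      rw [map_mul, evalHom_linearForm, evalHom_linearForm] at h1
      simp only [← Units.val_zpow_eq_zpow_val, mul_div_cancel, zpow_unit_zpow_unit, hy,
        zero_mul] at h1
      rw [← h1]
      refine Finset.sum_congr rfl fun i _ => ?_
      rw [← Units.val_mul]
      congr 1
      conv_lhs => rw [← zpow_unit_zpow_unit (y i) (s i), ← mul_zpow]
      congr 1
      rw [div_mul_eq_mul_div, mul_div_assoc]) i j
  exact Units.ext key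

/-- Automorphisms reduce this to `∑ i, x_i`, which is irreducible as a polynomial and stays a
nonunit because it has a zero in the torus. -/
theorem prime_linearForm {d : ℕ} (hd : 2 ≤ d) (ρ : Fin d → ℂˣ) (s : Fin d → ℤˣ) :
    Prime (linearForm ρ s) := by
  have h1 : Prime (linearForm (1 : Fin d → ℂˣ) 1) := by
    have h2 : linearForm (1 : Fin d → ℂˣ) 1 = toLaurent d (∑ i, MvPolynomial.X i) := by
      simp [linearForm, toLaurent_X, axisWeight]
    have h3 : Irreducible (∑ i : Fin d, MvPolynomial.X i : MvPolynomial (Fin d) ℂ) := by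
      have h4 := MvPolynomial.irreducible_sumSMulX
        (Finsupp.equivFunOnFinite.symm (1 : Fin d → ℂ))
        ⟨⟨0, by omega⟩, by simp⟩ (fun r hr => isUnit_of_dvd_one (by simpa using hr ⟨0, by omega⟩))
      have h5 : MvPolynomial.sumSMulX (Finsupp.equivFunOnFinite.symm (1 : Fin d → ℂ)) =
          ∑ i, MvPolynomial.X i := by
        rw [MvPolynomial.sumSMulX, Finsupp.linearCombination_apply, Finsupp.sum_fintype]
        · simp
        · simp
      rwa [h5] at h4
    rw [h2]
    refine prime_toLaurent h3 ?_
    rw [← h2]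
    intro hu
    obtain ⟨y, hy⟩ := exists_units_sum_eq_zero hd
    refine (hu.map (evalHom y)).ne_zero ?_
    rw [evalHom_linearForm]
    simpa using hy
  rw [← twist_linearForm_one, ← flip_linearForm_one]
  exact (MulEquiv.prime_iff (twistEquiv ρ)).2 ((MulEquiv.prime_iff (flipEquiv s)).2 h1)

/-- A product of linear forms that are permuted transitively by a group of substitutions has no
nontrivial factorization into invariant factors. -/
theorem isUnit_or_isUnit_of_mul_eq_prod_linearForm {d : ℕ} (hd : 2 ≤ d) {ι : Type*} [Fintype ι]
    (ρ : ι → Fin d → ℂˣ) (s : Fin d → ℤˣ) {i₀ : ι} (hi₀ : ρ i₀ = 1)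
    (hρ : ∀ m n, linearForm (ρ m) s ∣ linearForm (ρ n) s → m = n) {f g : LaurentPoly d} {c : ℂ}
    (hc : c ≠ 0) (hfg : f * g = single 0 c * ∏ n, linearForm (ρ n) s)
    (hf : ∀ n, twist (ρ n) f = f) (hg : ∀ n, twist (ρ n) g = g) : IsUnit f ∨ IsUnit g := by
  have hprime := prime_linearForm hd (1 : Fin d → ℂˣ) s
  have hcu : IsUnit (single 0 c : LaurentPoly d) := isUnit_single 0 hc
  have hprod0 : ∏ n, linearForm (ρ n) s ≠ 0 :=
    Finset.prod_ne_zero_iff.2 fun n _ => (prime_linearForm hd _ s).ne_zero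
  have key : ∀ f g : LaurentPoly d, f * g = single 0 c * ∏ n, linearForm (ρ n) s →
      (∀ n, twist (ρ n) f = f) → linearForm 1 s ∣ f → IsUnit g := by
    intro f g hfg hf hdvd
    have h1 : ∀ n, linearForm (ρ n) s ∣ f := by
      intro n
      have := map_dvd (twist (ρ n)) hdvd
      rwa [twist_linearForm_one, hf] at this
    -- Pairwise non-divisibility makes these primes coprime, so their product divides `f` and only a
    -- constant is left for `g`.
    obtain ⟨k, rfl⟩ : ∏ n, linearForm (ρ n) s ∣ f := by
      refine Finset.prod_dvd_of_isRelPrime ?_ fun n _ => h1 n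
      intro m _ n _ hmn
      exact (prime_linearForm hd (ρ m) s).irreducible.isRelPrime_iff_not_dvd.2
        fun h => hmn (hρ m n h)
    have h2 : k * g = single 0 c := by
      apply mul_left_cancel₀ hprod0
      rw [← mul_assoc, hfg, mul_comm]
    exact isUnit_of_mul_isUnit_right (h2 ▸ hcu)
  have h1 : linearForm 1 s ∣ f * g := by
    rw [hfg, ← hi₀]
    exact dvd_mul_of_dvd_right (Finset.dvd_prod_of_mem _ (Finset.mem_univ i₀)) _
  rcases hprime.dvd_or_dvd h1 with h | h
  · exact Or.inr (key f g hfg hf h)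
  · exact Or.inl (key g f (mul_comm f g ▸ hfg) hg h)

end DecoratedLattice

namespace DecoratedLattice

open AddMonoidAlgebra (single)
open scoped Matrix

/-! ### The Floquet matrix in the covering variables -/

/-- The index set of the fundamental domain of `ℤ^d`. -/
abbrev Box {d : ℕ} (q : Fin d → ℕ) : Type := (i : Fin d) → Fin (q i)

/-- The point of `ℤ^d` with a given index in the fundamental domain. -/
def Box.toPoint {d : ℕ} {q : Fin d → ℕ} (w : Box q) : Fin d → ℤ := fun i => ((w i : ℕ) : ℤ)

/-- The periods as an integer vector. -/
def period {d : ℕ} (q : Fin d → ℕ) : Fin d → ℤ := fun i => q i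

theorem bijective_toPoint_add {d : ℕ} {q : Fin d → ℕ} (hq : ∀ i, 0 < q i) :
    Function.Bijective fun p : Box q × (Fin d → ℤ) => p.1.toPoint + period q * p.2 := by
  constructor
  · rintro ⟨w, l⟩ ⟨w', l'⟩ h
    have h1 : ∀ i, ((w i : ℕ) : ℤ) + q i * l i = (w' i : ℕ) + q i * l' i := fun i => congrFun h i
    have h2 : ∀ i, ((w i : ℕ) : ℤ) = (w' i : ℕ) := by
      intro i
      have := congrArg (· % (q i : ℤ)) (h1 i)
      simp only [Int.add_mul_emod_self_left] at this
      rwa [Int.emod_eq_of_lt (by positivity) (by exact_mod_cast (w i).2),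
        Int.emod_eq_of_lt (by positivity) (by exact_mod_cast (w' i).2)] at this
    have h3 : ∀ i, l i = l' i := by
      intro i
      have h4 := h1 i
      rw [h2 i] at h4
      exact mul_left_cancel₀ (by exact_mod_cast (hq i).ne') (add_left_cancel h4)
    refine Prod.ext (funext fun i => Fin.ext ?_) (funext h3)
    exact_mod_cast h2 i
  · intro y
    have h : ∀ i, 0 ≤ y i % (q i : ℤ) ∧ y i % (q i : ℤ) < q i := fun i =>
      ⟨Int.emod_nonneg _ (by exact_mod_cast (hq i).ne'),
        Int.emod_lt_of_pos _ (by exact_mod_cast hq i)⟩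
    refine ⟨(fun i => ⟨(y i % (q i : ℤ)).toNat, by have := h i; omega⟩, fun i => y i / (q i : ℤ)),
      ?_⟩
    ext i
    have h1 := Int.emod_add_mul_ediv (y i) (q i)
    simpa [Box.toPoint, period, Int.toNat_of_nonneg (h i).1] using h1

theorem exists_axisWeight_of_sum_abs_eq_one {d : ℕ} {v : Fin d → ℤ} (h : ∑ i, |v i| = 1) :
    ∃ p : Fin d × ℤˣ, v = axisWeight p.1 p.2 := by
  obtain ⟨i, hi⟩ : ∃ i, v i ≠ 0 := by
    by_contra! h0
    simp [h0] at h
  have h1 := Finset.add_sum_erase Finset.univ (fun i => |v i|) (Finset.mem_univ i)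
  have h2 : 1 ≤ |v i| := Int.one_le_abs hi
  have h3 : 0 ≤ ∑ j ∈ Finset.univ.erase i, |v j| := Finset.sum_nonneg fun _ _ => abs_nonneg _
  have h4 : ∑ j ∈ Finset.univ.erase i, |v j| = 0 := by linarith
  have h5 : |v i| = 1 := by linarith
  rw [Finset.sum_eq_zero_iff_of_nonneg fun _ _ => abs_nonneg _] at h4
  have h6 : ∀ ε : ℤˣ, v i = ε → v = axisWeight i ε := by
    intro ε hε
    ext j
    by_cases hj : j = i
    · subst hj
      simp [axisWeight, hε]
    · simpa [axisWeight, hj] using h4 j (by simp [hj])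
  rcases (abs_eq zero_le_one).1 h5 with h7 | h7
  · exact ⟨(i, 1), h6 1 (by simpa using h7)⟩
  · exact ⟨(i, -1), h6 (-1) (by simpa using h7)⟩

theorem sum_abs_axisWeight {d : ℕ} (i : Fin d) (ε : ℤˣ) : ∑ j, |axisWeight i ε j| = 1 := by
  rw [Finset.sum_eq_single i]
  · rcases Int.units_eq_one_or ε with rfl | rfl <;> simp [axisWeight]
  · intro j _ hj
    simp [axisWeight, hj]
  · simp

theorem axisWeight_injective {d : ℕ} :
    Function.Injective fun p : Fin d × ℤˣ => axisWeight p.1 p.2 := by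
  rintro ⟨i, ε⟩ ⟨j, δ⟩ h
  have h1 := congrFun h i
  simp only [axisWeight, Pi.single_eq_same] at h1
  by_cases hij : i = j
  · subst hij
    rw [Pi.single_eq_same] at h1
    rw [Units.ext h1]
  · rw [Pi.single_eq_of_ne hij] at h1
    exact absurd h1 ε.ne_zero

/-- The character `y ↦ ∏ i, ρ_i ^ y_i` of `ℤ^d`. -/
def character {d : ℕ} (ρ : Fin d → ℂˣ) (y : Fin d → ℤ) : ℂˣ := ∏ i, ρ i ^ y i

theorem character_add {d : ℕ} (ρ : Fin d → ℂˣ) (y y' : Fin d → ℤ) :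
    character ρ (y + y') = character ρ y * character ρ y' := by
  simp only [character, ← Finset.prod_mul_distrib]
  exact Finset.prod_congr rfl fun i _ => zpow_add _ _ _

theorem character_period_mul {d : ℕ} {q : Fin d → ℕ} {ρ : Fin d → ℂˣ} (hρ : ∀ i, ρ i ^ q i = 1)
    (l : Fin d → ℤ) : character ρ (period q * l) = 1 := by
  refine Finset.prod_eq_one fun i _ => ?_
  rw [Pi.mul_apply, period, zpow_mul, zpow_natCast, hρ, one_zpow]

theorem character_axisWeight {d : ℕ} (ρ : Fin d → ℂˣ) (i : Fin d) (ε : ℤˣ) :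
    character ρ (axisWeight i ε) = ρ i ^ (ε : ℤ) := by
  rw [character, Finset.prod_eq_single i]
  · simp [axisWeight]
  · intro j _ hj
    simp [axisWeight, hj]
  · simp

/-- The symbol `∑ i, (ρ_i x_i + (ρ_i x_i)⁻¹)` of the Laplacian. -/
noncomputable def symbol {d : ℕ} (ρ : Fin d → ℂˣ) : LaurentPoly d :=
  ∑ p : Fin d × ℤˣ, single (axisWeight p.1 p.2) ((ρ p.1 ^ (p.2 : ℤ) : ℂˣ) : ℂ)

/-- The hopping matrix of `ℤ^d` in the covering variables, with entries `∑ x^(y - w)` over the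
neighbours `y` of `w` in the class of `w'`. -/
noncomputable def hopping {d : ℕ} (q : Fin d → ℕ) : Matrix (Box q) (Box q) (LaurentPoly d) :=
  Matrix.of fun w w' => ∑ᶠ l : Fin d → ℤ,
    single (w'.toPoint + period q * l - w.toPoint)
      (if ∑ i, |w.toPoint i - (w'.toPoint + period q * l) i| = 1 then 1 else 0)

theorem finite_support_hopping {d : ℕ} {q : Fin d → ℕ} (w : Box q) (c : (Fin d → ℤ) → ℂ) :
    (Function.support fun y : Fin d → ℤ => (single (y - w.toPoint)
      (if ∑ i, |w.toPoint i - y i| = 1 then c y else 0) : LaurentPoly d)) ⊆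
        (Finset.univ.image fun p : Fin d × ℤˣ => w.toPoint + axisWeight p.1 p.2) := by
  intro y hy
  rw [Function.mem_support] at hy
  split_ifs at hy with h
  · obtain ⟨p, hp⟩ := exists_axisWeight_of_sum_abs_eq_one (v := y - w.toPoint)
      (by simpa [abs_sub_comm] using h)
    simp only [Finset.coe_image, Finset.coe_univ, Set.image_univ, Set.mem_range]
    exact ⟨p, by rw [← hp]; abel⟩
  · simp at hy

theorem finsum_neighbours {d : ℕ} {q : Fin d → ℕ} (w : Box q) (ρ : Fin d → ℂˣ) :
    ∑ᶠ y : Fin d → ℤ, (single (y - w.toPoint)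
      (if ∑ i, |w.toPoint i - y i| = 1 then (character ρ y : ℂ) else 0) : LaurentPoly d) =
        symbol ρ * single 0 (character ρ w.toPoint : ℂ) := by
  rw [finsum_eq_sum_of_support_subset _ (finite_support_hopping w _), Finset.sum_image, symbol,
    Finset.sum_mul]
  · refine Finset.sum_congr rfl fun p _ => ?_
    have h : ∑ i, |w.toPoint i - (w.toPoint + axisWeight p.1 p.2) i| = 1 := by
      simpa using sum_abs_axisWeight p.1 p.2
    rw [if_pos h, AddMonoidAlgebra.single_mul_single, add_zero, character_add,
      character_axisWeight, add_sub_cancel_left, Units.val_mul, mul_comm]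
  · intro p _ p' _ h
    exact axisWeight_injective (add_left_cancel h)

/-- A character trivial on the period lattice is an eigenvector: the sums over `w'` and over
translates combine into one sum over `ℤ^d`, where only the neighbours of `w` contribute. -/
theorem sum_hopping_mul_character {d : ℕ} {q : Fin d → ℕ} (hq : ∀ i, 0 < q i) {ρ : Fin d → ℂˣ}
    (hρ : ∀ i, ρ i ^ q i = 1) (w : Box q) :
    ∑ w' : Box q, hopping q w w' * single 0 (character ρ w'.toPoint : ℂ) =
      symbol ρ * single 0 (character ρ w.toPoint : ℂ) := by
  obtain ⟨f, hf⟩ : ∃ f : (Fin d → ℤ) → LaurentPoly d, f = fun y => single (y - w.toPoint)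
      (if ∑ i, |w.toPoint i - y i| = 1 then (character ρ y : ℂ) else 0) := ⟨_, rfl⟩
  have hfin : f.support.Finite := by
    rw [hf]
    exact (Finset.finite_toSet _).subset (finite_support_hopping w _)
  have hbij := bijective_toPoint_add hq
  rw [← finsum_neighbours, ← hf, ← finsum_comp_equiv (Equiv.ofBijective _ hbij)]
  rw [finsum_curry _ (hfin.preimage (Equiv.ofBijective _ hbij).injective.injOn),
    finsum_eq_sum_of_fintype]
  refine Finset.sum_congr rfl fun w' _ => ?_
  rw [hopping, Matrix.of_apply, finsum_mul']
  · refine finsum_congr fun l => ?_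
    rw [hf]
    simp only [Equiv.ofBijective_apply, AddMonoidAlgebra.single_mul_single, add_zero]
    rw [character_add, character_period_mul hρ, mul_one, ite_mul, one_mul, zero_mul]
  · have h1 := (Finset.finite_toSet _).subset (finite_support_hopping w fun _ => 1)
    refine (h1.preimage (f := fun l => w'.toPoint + period q * l) ?_).subset fun l hl => hl
    intro l _ l' _ h
    have := hbij.1 (a₁ := (w', l)) (a₂ := (w', l')) h
    exact congrArg Prod.snd this

end DecoratedLattice

/-! ### Diagonalization of the hopping and the faces of the resulting Newton polytope. -/

namespace DecoratedLattice

open AddMonoidAlgebra (single)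
open scoped Matrix

/-! ### The Fourier transform on the fundamental domain -/

theorem exists_isPrimitiveRoot_units {n : ℕ} (hn : 0 < n) : ∃ ζ : ℂˣ, IsPrimitiveRoot ζ n := by
  have h := Complex.isPrimitiveRoot_exp n hn.ne'
  exact ⟨(h.isUnit hn.ne').unit, IsPrimitiveRoot.coe_units_iff.1 h⟩

/-- The tuple of roots of unity `(ζ_i ^ n_i)`. -/
def rootTuple {d : ℕ} {q : Fin d → ℕ} (ζ : Fin d → ℂˣ) (n : Box q) : Fin d → ℂˣ :=
  fun i => ζ i ^ (n i : ℕ)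

theorem rootTuple_pow {d : ℕ} {q : Fin d → ℕ} {ζ : Fin d → ℂˣ}
    (hζ : ∀ i, IsPrimitiveRoot (ζ i) (q i)) (n : Box q) (i : Fin d) :
    rootTuple ζ n i ^ q i = 1 := by
  rw [rootTuple, ← pow_mul, mul_comm, pow_mul, (hζ i).pow_eq_one, one_pow]

theorem rootTuple_injective {d : ℕ} {q : Fin d → ℕ} {ζ : Fin d → ℂˣ}
    (hζ : ∀ i, IsPrimitiveRoot (ζ i) (q i)) :
    Function.Injective (rootTuple ζ : Box q → Fin d → ℂˣ) := by
  intro n m h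
  ext i
  exact (hζ i).pow_inj (n i).2 (m i).2 (congrFun h i)

/-- The Fourier matrix of the fundamental domain. -/
noncomputable def fourier {d : ℕ} {q : Fin d → ℕ} (ζ : Fin d → ℂˣ) : Matrix (Box q) (Box q) ℂ :=
  Matrix.of fun w n => (character (rootTuple ζ n) w.toPoint : ℂ)

theorem sum_character_rootTuple {d : ℕ} {q : Fin d → ℕ} {ζ : Fin d → ℂˣ}
    (hζ : ∀ i, IsPrimitiveRoot (ζ i) (q i)) (n m : Box q) :
    ∑ w : Box q, (character (rootTuple ζ m / rootTuple ζ n) w.toPoint : ℂ) =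
      if n = m then ∏ i, (q i : ℂ) else 0 := by
  obtain ⟨r, hr⟩ : ∃ r : Fin d → ℂˣ, r = rootTuple ζ m / rootTuple ζ n := ⟨_, rfl⟩
  have h1 : ∑ w : Box q, (character r w.toPoint : ℂ) =
      ∏ i, ∑ k : Fin (q i), (r i : ℂ) ^ (k : ℕ) := by
    rw [Finset.prod_univ_sum, Fintype.piFinset_univ]
    refine Finset.sum_congr rfl fun w _ => ?_
    rw [character, Units.coe_prod]
    refine Finset.prod_congr rfl fun i _ => ?_
    rw [Box.toPoint, zpow_natCast, Units.val_pow_eq_pow_val]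
  rw [← hr, h1]
  split_ifs with h
  · subst h
    rw [div_self'] at hr
    simp [hr]
  · obtain ⟨i, hi⟩ : ∃ i, r i ≠ 1 := by
      by_contra! h2
      refine h (rootTuple_injective hζ ?_)
      rw [eq_comm, ← div_eq_one, ← hr]
      exact funext h2
    refine Finset.prod_eq_zero (Finset.mem_univ i) ?_
    have h3 : r i ^ q i = 1 := by
      rw [hr, Pi.div_apply, div_pow, rootTuple_pow hζ, rootTuple_pow hζ, div_one]
    rw [Fin.sum_univ_eq_sum_range (fun k => (r i : ℂ) ^ k)]
    have h4 := geom_sum_mul (r i : ℂ) (q i)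
    rw [← Units.val_pow_eq_pow_val, h3, Units.val_one, sub_self] at h4
    exact (mul_eq_zero.1 h4).resolve_right fun h5 => hi (Units.ext (sub_eq_zero.1 h5))

theorem isUnit_det_fourier {d : ℕ} {q : Fin d → ℕ} (hq : ∀ i, 0 < q i) {ζ : Fin d → ℂˣ}
    (hζ : ∀ i, IsPrimitiveRoot (ζ i) (q i)) :
    IsUnit (fourier ζ : Matrix (Box q) (Box q) ℂ).det := by
  have h : (Matrix.of fun n w : Box q => ((character (rootTuple ζ n) w.toPoint)⁻¹ : ℂ)) *
      fourier ζ = Matrix.diagonal fun _ => ∏ i, (q i : ℂ) := by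
    ext n m
    rw [Matrix.mul_apply, Matrix.diagonal_apply, ← sum_character_rootTuple hζ]
    refine Finset.sum_congr rfl fun w _ => ?_
    simp only [fourier, Matrix.of_apply, character, ← Units.val_inv_eq_inv_val, ← Units.val_mul]
    congr 1
    rw [← Finset.prod_inv_distrib, ← Finset.prod_mul_distrib]
    refine Finset.prod_congr rfl fun i _ => ?_
    rw [Pi.div_apply, div_zpow, div_eq_inv_mul]
  have h1 := congrArg Matrix.det h
  rw [Matrix.det_mul, Matrix.det_diagonal] at h1
  refine IsUnit.mk0 _ fun h2 => ?_
  rw [h2, mul_zero] at h1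
  refine Finset.prod_ne_zero_iff.2 (fun _ _ => Finset.prod_ne_zero_iff.2 fun i _ => ?_) h1.symm
  exact_mod_cast (hq i).ne'

theorem algebraMap_laurentPoly {d : ℕ} (c : ℂ) :
    algebraMap ℂ (LaurentPoly d) c = single 0 c := rfl

/-- The Fourier matrix has constant entries, so conjugation by it diagonalizes the hopping and keeps
the perturbation constant. -/
theorem exists_det_hopping_add {d : ℕ} {q : Fin d → ℕ} (hq : ∀ i, 0 < q i) {ζ : Fin d → ℂˣ}
    (hζ : ∀ i, IsPrimitiveRoot (ζ i) (q i)) (U : Matrix (Box q) (Box q) ℂ) :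
    ∃ U' : Matrix (Box q) (Box q) ℂ, (hopping q + U.map (algebraMap ℂ (LaurentPoly d))).det =
      (Matrix.diagonal (fun n => symbol (rootTuple ζ n)) +
        U'.map (algebraMap ℂ (LaurentPoly d))).det := by
  obtain ⟨E, hE⟩ : ∃ E : Matrix (Box q) (Box q) ℂ, E = fourier ζ := ⟨_, rfl⟩
  have hu : IsUnit E.det := hE ▸ isUnit_det_fourier hq hζ
  refine ⟨E⁻¹ * U * E, ?_⟩
  have h1 : hopping q * E.map (algebraMap ℂ (LaurentPoly d)) =
      E.map (algebraMap ℂ (LaurentPoly d)) * Matrix.diagonal fun n => symbol (rootTuple ζ n) := by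
    ext1 w n
    rw [Matrix.mul_apply, Matrix.mul_diagonal, Matrix.map_apply, algebraMap_laurentPoly, mul_comm]
    simp only [hE, fourier, Matrix.map_apply, Matrix.of_apply, algebraMap_laurentPoly]
    exact sum_hopping_mul_character hq (rootTuple_pow hζ n) w
  have h2 : U.map (algebraMap ℂ (LaurentPoly d)) * E.map (algebraMap ℂ (LaurentPoly d)) =
      E.map (algebraMap ℂ (LaurentPoly d)) *
        (E⁻¹ * U * E).map (algebraMap ℂ (LaurentPoly d)) := by
    rw [← Matrix.map_mul, ← Matrix.map_mul, mul_assoc E⁻¹, Matrix.mul_nonsing_inv_cancel_left _ _ hu]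
  have h3 := congrArg Matrix.det (show
    (hopping q + U.map (algebraMap ℂ (LaurentPoly d))) * E.map (algebraMap ℂ (LaurentPoly d)) =
      E.map (algebraMap ℂ (LaurentPoly d)) *
        (Matrix.diagonal (fun n => symbol (rootTuple ζ n)) +
          (E⁻¹ * U * E).map (algebraMap ℂ (LaurentPoly d))) by
      rw [add_mul, mul_add, h1, h2])
  rw [Matrix.det_mul, Matrix.det_mul, mul_comm] at h3
  refine mul_left_cancel₀ ?_ h3
  rw [← RingHom.mapMatrix_apply, ← RingHom.map_det]
  exact (hu.map _).ne_zero

/-! ### Leading forms of the determinant -/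

theorem symbol_eq_add {d : ℕ} (ρ : Fin d → ℂˣ) (s : Fin d → ℤˣ) :
    symbol ρ = linearForm ρ s + linearForm ρ (-s) := by
  have h : ∀ (f : ℤˣ → LaurentPoly d) (δ : ℤˣ), ∑ ε, f ε = f δ + f (-δ) := by
    intro f δ
    rw [show (Finset.univ : Finset ℤˣ) = {1, -1} from rfl, Finset.sum_pair (by decide)]
    rcases Int.units_eq_one_or δ with rfl | rfl
    · rfl
    · rw [neg_neg, add_comm]
  rw [symbol, Fintype.sum_prod_type, linearForm, linearForm, ← Finset.sum_add_distrib]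
  refine Finset.sum_congr rfl fun i _ => ?_
  rw [h _ (s i)]
  simp only [Pi.neg_apply, Units.val_zpow_eq_zpow_val]

theorem algebraMap_mem_lowerThan {d : ℕ} (t : Fin d → ℤ) (c : ℂ) :
    algebraMap ℂ (LaurentPoly d) c ∈ lowerThan t 1 :=
  single_mem_supportedIn (by simp) c

/-- Each symbol splits into a part of weight `1` and a part of weight `-1`; constants have weight
`0`. -/
theorem isLeadingForm_sign {d : ℕ} (hd : 2 ≤ d) {ι : Type*} [Fintype ι] [DecidableEq ι]
    (ρ : ι → Fin d → ℂˣ) (U : Matrix ι ι ℂ) (s : Fin d → ℤˣ) :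
    IsLeadingForm (signWeight s) (Fintype.card ι)
      (Matrix.diagonal (fun n => symbol (ρ n)) + U.map (algebraMap ℂ (LaurentPoly d))).det
      (∏ n, linearForm (ρ n) s) := by
  have h : (Matrix.diagonal fun n => symbol (ρ n)) + U.map (algebraMap ℂ (LaurentPoly d)) =
      (Matrix.diagonal fun n => linearForm (ρ n) s) +
        ((Matrix.diagonal fun n => linearForm (ρ n) (-s)) +
          U.map (algebraMap ℂ (LaurentPoly d))) := by
    rw [← add_assoc, Matrix.diagonal_add]
    simp only [symbol_eq_add _ s]
  rw [h]
  refine isLeadingForm_det_diagonal_add _ _ (fun n => linearForm_mem_homogeneous _ _) ?_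
    fun n => (prime_linearForm hd _ _).ne_zero
  intro m n
  refine add_mem ?_ (algebraMap_mem_lowerThan _ _)
  rw [Matrix.diagonal_apply]
  split_ifs
  · refine supportedIn_mono ?_ (linearForm_mem_homogeneous _ _)
    intro α (hα : signWeight (-s) ⬝ᵥ α = 1)
    have h1 : signWeight (-s) = -signWeight s := by
      ext i
      simp [signWeight]
    rw [h1, neg_dotProduct] at hα
    change signWeight s ⬝ᵥ α < 1
    omega
  · exact zero_mem _

/-- Of the `2d` monomials in a symbol, only `x_i ^ ε` has weight `1`. -/
theorem isLeadingForm_axis {d : ℕ} {ι : Type*} [Fintype ι] [DecidableEq ι]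
    (ρ : ι → Fin d → ℂˣ) (U : Matrix ι ι ℂ) (i : Fin d) (ε : ℤˣ) :
    IsLeadingForm (axisWeight i ε) (Fintype.card ι)
      (Matrix.diagonal (fun n => symbol (ρ n)) + U.map (algebraMap ℂ (LaurentPoly d))).det
      (∏ n, single (axisWeight i ε) ((ρ n i ^ (ε : ℤ) : ℂˣ) : ℂ)) := by
  have h : (Matrix.diagonal fun n => symbol (ρ n)) + U.map (algebraMap ℂ (LaurentPoly d)) =
      (Matrix.diagonal fun n => single (axisWeight i ε) ((ρ n i ^ (ε : ℤ) : ℂˣ) : ℂ)) +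
        ((Matrix.diagonal fun n => ∑ p ∈ Finset.univ.erase (i, ε),
          single (axisWeight p.1 p.2) ((ρ n p.1 ^ (p.2 : ℤ) : ℂˣ) : ℂ)) +
            U.map (algebraMap ℂ (LaurentPoly d))) := by
    rw [← add_assoc, Matrix.diagonal_add]
    congr 2
    ext1 n
    exact (Finset.add_sum_erase Finset.univ
      (fun p : Fin d × ℤˣ => single (axisWeight p.1 p.2) ((ρ n p.1 ^ (p.2 : ℤ) : ℂˣ) : ℂ))
      (Finset.mem_univ (i, ε))).symm
  rw [h]
  refine isLeadingForm_det_diagonal_add _ _ (fun n => single_mem_supportedIn ?_ _) ?_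
    fun n => (isUnit_single _ (Units.ne_zero _)).ne_zero
  · change axisWeight i ε ⬝ᵥ axisWeight i ε = 1
    rw [axisWeight_dotProduct, axisWeight, Pi.single_eq_same, ← Units.val_mul,
      Int.units_mul_self, Units.val_one]
  intro m n
  refine add_mem ?_ (algebraMap_mem_lowerThan _ _)
  rw [Matrix.diagonal_apply]
  split_ifs
  · refine sum_mem fun p hp => single_mem_supportedIn ?_ _
    change axisWeight i ε ⬝ᵥ axisWeight p.1 p.2 < 1
    rw [axisWeight_dotProduct, axisWeight]
    by_cases hpi : i = p.1
    · rw [hpi, Pi.single_eq_same]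
      have hne : p.2 ≠ ε := fun h => (Finset.mem_erase.1 hp).1 (Prod.ext hpi.symm h)
      rw [Int.units_ne_iff_eq_neg.1 hne]
      rcases Int.units_eq_one_or ε with rfl | rfl <;> simp
    · rw [Pi.single_eq_of_ne hpi, mul_zero]
      exact one_pos
  · exact zero_mem _

theorem prod_single {d : ℕ} {ι : Type*} (S : Finset ι) (α : Fin d → ℤ) (c : ι → ℂ) :
    ∏ n ∈ S, (single α (c n) : LaurentPoly d) = single ((S.card : ℤ) • α) (∏ n ∈ S, c n) := by
  classical
  induction S using Finset.induction_on with
  | empty => simp [AddMonoidAlgebra.one_def]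
  | insert i S hi ih =>
    rw [Finset.prod_insert hi, Finset.prod_insert hi, ih, AddMonoidAlgebra.single_mul_single,
      Finset.card_insert_of_notMem hi, Nat.cast_succ, add_smul, one_smul, add_comm]

theorem IsLeadingForm.const_mul {d : ℕ} {t : Fin d → ℤ} {k : ℤ} {F f : LaurentPoly d}
    (h : IsLeadingForm t k F f) {c : ℂ} (hc : c ≠ 0) :
    IsLeadingForm t k (single 0 c * F) (single 0 c * f) := by
  have h1 : IsLeadingForm t 0 (single 0 c : LaurentPoly d) (single 0 c) :=
    ⟨(isUnit_single 0 hc).ne_zero, single_mem_supportedIn (by simp) c, by simp⟩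
  simpa using h1.mul h

end DecoratedLattice

namespace DecoratedLattice

open AddMonoidAlgebra (single)
open scoped Matrix

/-! ### Reduction of the Floquet matrix to the hopping matrix -/

/-- The substitution `z_i = x_i ^ (q i)`. -/
noncomputable def expand {d : ℕ} (q : Fin d → ℕ) : LaurentPoly d →ₐ[ℂ] LaurentPoly d :=
  AddMonoidAlgebra.mapDomainAlgHom ℂ ℂ (AddMonoidHom.mulLeft (period q))

theorem expand_single {d : ℕ} (q : Fin d → ℕ) (α : Fin d → ℤ) (c : ℂ) :
    expand q (single α c) = single (period q * α) c :=
  AddMonoidAlgebra.mapDomain_single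

theorem period_mul_injective {d : ℕ} {q : Fin d → ℕ} (hq : ∀ i, 0 < q i) :
    Function.Injective fun α : Fin d → ℤ => period q * α := by
  intro α β h
  ext i
  exact mul_left_cancel₀ (by exact_mod_cast (hq i).ne' : (q i : ℤ) ≠ 0) (congrFun h i)

theorem expand_injective {d : ℕ} {q : Fin d → ℕ} (hq : ∀ i, 0 < q i) :
    Function.Injective (expand q) :=
  AddMonoidAlgebra.mapDomain_injective (period_mul_injective hq)

theorem expand_mem_supportedIn {d : ℕ} (q : Fin d → ℕ) (f : LaurentPoly d) :
    expand q f ∈ supportedIn (Set.range fun α => period q * α) := by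
  induction f using AddMonoidAlgebra.induction_linear with
  | zero => simp
  | add f g hf hg => rw [map_add]; exact add_mem hf hg
  | single α c =>
    rw [expand_single]
    exact single_mem_supportedIn (Set.mem_range_self α) c

theorem isUnit_of_isUnit_expand {d : ℕ} {q : Fin d → ℕ} (hq : ∀ i, 0 < q i) {f : LaurentPoly d}
    (h : IsUnit (expand q f)) : IsUnit f := by
  obtain ⟨β, c, hc, hβ⟩ := isUnit_iff.1 h
  have h1 := expand_mem_supportedIn q f
  rw [hβ] at h1
  obtain ⟨α, hα⟩ : β ∈ Set.range fun α => period q * α := h1 β (by simpa using hc)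
  have h2 : f = single α c := expand_injective hq (by
    rw [hβ, expand_single]
    exact congrArg (single · c) hα.symm)
  rw [h2]
  exact isUnit_single α hc

theorem evalHom_expand {d : ℕ} (q : Fin d → ℕ) (x : Fin d → ℂˣ) (f : LaurentPoly d) :
    evalHom x (expand q f) = evalHom (fun i => x i ^ q i) f := by
  have h : (evalHom x).comp (expand q) = evalHom fun i => x i ^ q i := by
    apply AddMonoidAlgebra.algHom_ext
    · intro α
      rw [AlgHom.comp_apply, expand_single, evalHom_single, evalHom_single]
      congr 1
      refine Finset.prod_congr rfl fun i _ => ?_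
      rw [Pi.mul_apply, period, zpow_mul, zpow_natCast, Units.val_pow_eq_pow_val]
    · exact Subsingleton.elim _ _
  rw [← h]
  rfl

theorem translate_fst {d ν : ℕ} (q : Fin d → ℕ) (l : Fin d → ℤ) (x : Vertex d ν) :
    (translate q l x).1 = x.1 + period q * l := by
  ext i
  simp [translate, period, mul_comm]

/-- The matrix entries of the Hamiltonian split into hopping between lattice points and the part
inside the decorations. -/
theorem hamiltonian_eq {d ν : ℕ} (V : Vertex d ν → ℂ) (x y : Vertex d ν) :
    hamiltonian d ν V x y =
      (if x.2 = 0 ∧ y.2 = 0 then (if ∑ i, |x.1 i - y.1 i| = 1 then 1 else 0) else 0) +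
        if x.1 = y.1 then hamiltonian d ν V x (x.1, y.2) else 0 := by
  classical
  by_cases h : x.1 = y.1
  · have hy : y = (x.1, y.2) := by rw [h]
    rw [if_pos h, ← hy]
    simp [h]
  · have hne : x ≠ y := fun h' => h (congrArg Prod.fst h')
    rw [if_neg h, add_zero, hamiltonian, Matrix.add_apply, Matrix.diagonal_apply_ne _ hne, add_zero,
      SimpleGraph.adjMatrix_apply, ← ite_and]
    refine if_congr ?_ rfl rfl
    simp only [graph, h, false_and, or_false, and_assoc]
    exact and_iff_right hne

/-- The part of the Floquet matrix at energy `0` inside the decorations. -/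
noncomputable def localMatrix {d ν : ℕ} (q : Fin d → ℕ) (V : Vertex d ν → ℂ) :
    Matrix (Cell ν q) (Cell ν q) ℂ :=
  Matrix.of fun a b => if a.1 = b.1 then hamiltonian d ν V a.toVertex (a.toVertex.1, b.2) else 0

/-- A matrix on lattice points as a matrix on the vertices of the decorated lattice. -/
def onLattice {ι R : Type*} {ν : ℕ} [Zero R] (A : Matrix ι ι R) :
    Matrix (ι × ZMod ν) (ι × ZMod ν) R :=
  Matrix.of fun a b => if a.2 = 0 ∧ b.2 = 0 then A a.1 b.1 else 0

theorem toVertex_fst {d ν : ℕ} {q : Fin d → ℕ} (a : Cell ν q) :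
    a.toVertex.1 = Box.toPoint a.1 := rfl

theorem toPoint_eq_add_iff {d : ℕ} {q : Fin d → ℕ} (hq : ∀ i, 0 < q i) {w w' : Box q}
    {l : Fin d → ℤ} : w.toPoint = w'.toPoint + period q * l ↔ l = 0 ∧ w = w' := by
  constructor
  · intro h
    have := (bijective_toPoint_add hq).1 (a₁ := (w, 0)) (a₂ := (w', l)) (by simpa using h)
    exact ⟨(congrArg Prod.snd this).symm, congrArg Prod.fst this⟩
  · rintro ⟨rfl, rfl⟩
    simp

theorem finite_support_hopping_entry {d : ℕ} {q : Fin d → ℕ} (hq : ∀ i, 0 < q i) (w w' : Box q) :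
    (Function.support fun l : Fin d → ℤ => (single (w'.toPoint + period q * l - w.toPoint)
      (if ∑ i, |w.toPoint i - (w'.toPoint + period q * l) i| = 1 then 1 else 0) :
        LaurentPoly d)).Finite := by
  have h1 := (Finset.finite_toSet _).subset (finite_support_hopping w fun _ => 1)
  refine (h1.preimage (f := fun l => w'.toPoint + period q * l) ?_).subset fun l hl => hl
  intro l _ l' _ h
  exact period_mul_injective hq (add_left_cancel h)

/-- Conjugation by the monomials `x^w` turns the factor `z^l` into `x` to the displacement between
the two lattice points. Terms inside a decoration have displacement `0`, hence are constant. -/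
theorem conj_expand_floquetMatrix {d ν : ℕ} {q : Fin d → ℕ} (hq : ∀ i, 0 < q i)
    (V : Vertex d ν → ℂ) (a b : Cell ν q) :
    single (-Box.toPoint a.1) 1 * expand q (floquetMatrix q V a b) * single (Box.toPoint b.1) 1 =
      (onLattice (hopping q) + (localMatrix q V).map (algebraMap ℂ (LaurentPoly d)) :
        Matrix (Cell ν q) (Cell ν q) (LaurentPoly d)) a b := by
  have hfin : (Function.support fun l : Fin d → ℤ => (single l
      (hamiltonian d ν V a.toVertex (translate q l b.toVertex)) : LaurentPoly d)).Finite := by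
    refine (finite_support_hamiltonian V hq a.toVertex b.toVertex).subset fun l hl => ?_
    simpa using hl
  have h1 : single (-Box.toPoint a.1) 1 * expand q (floquetMatrix q V a b) *
      single (Box.toPoint b.1) 1 =
        ∑ᶠ l : Fin d → ℤ, (single (Box.toPoint b.1 + period q * l - Box.toPoint a.1)
          (hamiltonian d ν V a.toVertex (translate q l b.toVertex)) : LaurentPoly d) := by
    rw [floquetMatrix, Matrix.of_apply]
    have h2 := AddMonoidHom.map_finsum (((AddMonoidHom.mulRight
      (single (Box.toPoint b.1) 1 : LaurentPoly d)).comp (AddMonoidHom.mulLeft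
        (single (-Box.toPoint a.1) 1 : LaurentPoly d))).comp
          ((expand q : LaurentPoly d →+* LaurentPoly d) : LaurentPoly d →+ LaurentPoly d)) hfin
    refine h2.trans (finsum_congr fun l => ?_)
    change single (-Box.toPoint a.1) 1 * expand q (single l _) * single (Box.toPoint b.1) 1 = _
    rw [expand_single, AddMonoidAlgebra.single_mul_single, AddMonoidAlgebra.single_mul_single,
      one_mul, mul_one]
    congr 1
    abel
  have h2 : ∀ l : Fin d → ℤ, (single (Box.toPoint b.1 + period q * l - Box.toPoint a.1)
      (hamiltonian d ν V a.toVertex (translate q l b.toVertex)) : LaurentPoly d) =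
        (if a.2 = 0 ∧ b.2 = 0 then
          single (Box.toPoint b.1 + period q * l - Box.toPoint a.1)
            (if ∑ i, |Box.toPoint a.1 i - (Box.toPoint b.1 + period q * l) i| = 1 then 1 else 0)
          else 0) + if l = 0 then single 0 (localMatrix q V a b) else 0 := by
    intro l
    rw [hamiltonian_eq, translate_fst, toVertex_fst, toVertex_fst, AddMonoidAlgebra.single_add]
    congr 1
    · split_ifs with h3 h4 h5 h5 <;> first | rfl | simp_all [Cell.toVertex, translate]
    · simp only [toPoint_eq_add_iff hq, localMatrix, Matrix.of_apply]
      by_cases hl : l = 0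
      · subst hl
        by_cases hab : a.1 = b.1
        · simp [hab, Cell.toVertex, translate]
          rfl
        · simp [hab]
      · simp [hl]
  rw [h1, finsum_congr h2, finsum_add_distrib]
  · rw [Matrix.add_apply, Matrix.map_apply, algebraMap_laurentPoly, onLattice, Matrix.of_apply]
    congr 1
    · split_ifs
      · rfl
      · exact finsum_zero
    · exact finsum_eq_single _ _ (fun l hl => if_neg hl) |>.trans (if_pos rfl)
  · split_ifs
    · exact finite_support_hopping_entry hq _ _
    · simp [Function.HasFiniteSupport]
  · exact (Set.finite_singleton (0 : Fin d → ℤ)).subset fun l hl => by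
      by_contra h
      exact hl (if_neg h)

theorem expand_dispersion {d ν : ℕ} [NeZero ν] {q : Fin d → ℕ} (hq : ∀ i, 0 < q i)
    (V : Vertex d ν → ℂ) (lam : ℂ) :
    expand q (dispersion q V lam) = (onLattice (hopping q) +
      (localMatrix q V - Matrix.scalar _ lam).map (algebraMap ℂ (LaurentPoly d)) :
        Matrix (Cell ν q) (Cell ν q) (LaurentPoly d)).det := by
  obtain ⟨M, hM⟩ : ∃ M, M = floquetMatrix q V -
    Matrix.scalar (Cell ν q) (algebraMap ℂ (LaurentPoly d) lam) := ⟨_, rfl⟩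
  have h1 : onLattice (hopping q) +
      (localMatrix q V - Matrix.scalar (Cell ν q) lam).map (algebraMap ℂ (LaurentPoly d)) =
        Matrix.diagonal (fun a : Cell ν q => single (-Box.toPoint a.1) (1 : ℂ)) *
          (expand q).mapMatrix M *
            Matrix.diagonal fun a : Cell ν q => single (Box.toPoint a.1) (1 : ℂ) := by
    ext1 a b
    rw [Matrix.mul_diagonal, Matrix.diagonal_mul, AlgHom.mapMatrix_apply, Matrix.map_apply, hM,
      Matrix.sub_apply, map_sub, mul_sub, sub_mul, conj_expand_floquetMatrix hq,
      Matrix.add_apply, Matrix.add_apply, Matrix.map_apply, Matrix.map_apply, Matrix.sub_apply,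
      map_sub, add_sub_assoc]
    congr 2
    rw [Matrix.scalar_apply, Matrix.scalar_apply, Matrix.diagonal_apply, Matrix.diagonal_apply]
    split_ifs with h
    · subst h
      rw [AlgHom.commutes, mul_right_comm, AddMonoidAlgebra.single_mul_single, neg_add_cancel,
        mul_one, ← AddMonoidAlgebra.one_def, one_mul]
    · simp
  rw [h1, Matrix.det_mul, Matrix.det_mul, Matrix.det_diagonal, Matrix.det_diagonal,
    mul_right_comm, ← Finset.prod_mul_distrib, Finset.prod_eq_one, one_mul, dispersion, ← hM,
    AlgHom.map_det]
  intro a _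
  rw [AddMonoidAlgebra.single_mul_single, neg_add_cancel, mul_one, AddMonoidAlgebra.one_def]

/-- Elimination of the decorations by the Schur complement. -/
theorem exists_det_onLattice_add {ι R : Type*} [Fintype ι] [DecidableEq ι] [CommRing R]
    [Algebra ℂ R] {ν : ℕ} [NeZero ν] (A : Matrix ι ι R)
    (N : Matrix (ι × ZMod ν) (ι × ZMod ν) ℂ)
    (hN : (N.toBlock (fun a => ¬ a.2 = 0) (fun a => ¬ a.2 = 0)).det ≠ 0) :
    ∃ U : Matrix ι ι ℂ, (onLattice A + N.map (algebraMap ℂ R)).det =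
      algebraMap ℂ R (N.toBlock (fun a => ¬ a.2 = 0) (fun a => ¬ a.2 = 0)).det *
        (A + U.map (algebraMap ℂ R)).det := by
  obtain ⟨D, hD⟩ : ∃ D, D = N.toBlock (fun a => ¬ a.2 = 0) (fun a => ¬ a.2 = 0) := ⟨_, rfl⟩
  rw [← hD] at hN ⊢
  have hu : IsUnit D.det := IsUnit.mk0 _ hN
  let e : ι ≃ {a : ι × ZMod ν // a.2 = 0} :=
    { toFun := fun i => ⟨(i, 0), rfl⟩
      invFun := fun a => a.1.1
      left_inv := fun i => rfl
      right_inv := fun a => Subtype.ext (Prod.ext rfl a.2.symm) }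
  let : Invertible (D.map (algebraMap ℂ R)) :=
    ⟨D⁻¹.map (algebraMap ℂ R),
      by rw [← Matrix.map_mul, Matrix.nonsing_inv_mul _ hu, Matrix.map_one _ (map_zero _) (map_one _)],
      by rw [← Matrix.map_mul, Matrix.mul_nonsing_inv _ hu, Matrix.map_one _ (map_zero _) (map_one _)]⟩
  -- `A` occupies only the block of lattice points; the other three blocks are constant, so the
  -- Schur correction is constant too.
  obtain ⟨S, hS⟩ : ∃ S, S = N.toBlock (fun a => a.2 = 0) (fun a => a.2 = 0) -
    N.toBlock (fun a => a.2 = 0) (fun a => ¬ a.2 = 0) * D⁻¹ *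
      N.toBlock (fun a => ¬ a.2 = 0) (fun a => a.2 = 0) := ⟨_, rfl⟩
  refine ⟨S.submatrix e e, ?_⟩
  rw [Matrix.det_toBlock _ fun a => a.2 = 0]
  have h22 : (onLattice A + N.map (algebraMap ℂ R)).toBlock (fun a => ¬ a.2 = 0)
      (fun a => ¬ a.2 = 0) = D.map (algebraMap ℂ R) := by
    ext1 a b
    simp [hD, Matrix.toBlock_apply, onLattice, a.2]
  have h12 : (onLattice A + N.map (algebraMap ℂ R)).toBlock (fun a => a.2 = 0)
      (fun a => ¬ a.2 = 0) =
        (N.toBlock (fun a => a.2 = 0) (fun a => ¬ a.2 = 0)).map (algebraMap ℂ R) := by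
    ext1 a b
    simp [Matrix.toBlock_apply, onLattice, b.2]
  have h21 : (onLattice A + N.map (algebraMap ℂ R)).toBlock (fun a => ¬ a.2 = 0)
      (fun a => a.2 = 0) =
        (N.toBlock (fun a => ¬ a.2 = 0) (fun a => a.2 = 0)).map (algebraMap ℂ R) := by
    ext1 a b
    simp [Matrix.toBlock_apply, onLattice, a.2]
  rw [h12, h21, h22, Matrix.det_fromBlocks₂₂]
  congr 1
  · exact (RingHom.map_det (algebraMap ℂ R) D).symm
  · rw [← Matrix.det_submatrix_equiv_self e]
    congr 1
    have h3 : ⅟(D.map (algebraMap ℂ R)) = D⁻¹.map (algebraMap ℂ R) := rfl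
    rw [h3, ← Matrix.map_mul, ← Matrix.map_mul]
    ext1 i j
    have h4 : (onLattice A + N.map (algebraMap ℂ R)).toBlock (fun a => a.2 = 0)
        (fun a => a.2 = 0) (e i) (e j) = A i j +
          algebraMap ℂ R (N.toBlock (fun a => a.2 = 0) (fun a => a.2 = 0) (e i) (e j)) := by
      simp [Matrix.toBlock_apply, onLattice, e]
    rw [Matrix.submatrix_apply, Matrix.sub_apply, h4, Matrix.add_apply, Matrix.map_apply,
      Matrix.map_apply, Matrix.submatrix_apply, hS, Matrix.sub_apply, map_sub, add_sub_assoc]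

end DecoratedLattice

namespace DecoratedLattice

open AddMonoidAlgebra (single)
open scoped Matrix

/-! ### Irreducibility -/

theorem finite_setOf_det_sub_scalar_eq_zero {ι : Type*} [Fintype ι] [DecidableEq ι]
    (B : Matrix ι ι ℂ) : {lam : ℂ | (B - Matrix.scalar ι lam).det = 0}.Finite := by
  refine (Polynomial.finite_setOfPred_isRoot B.charpoly_monic.ne_zero).subset fun lam hlam => ?_
  change Polynomial.eval lam B.charpoly = 0
  rw [Matrix.eval_charpoly, ← neg_sub, Matrix.det_neg]
  exact mul_eq_zero_of_right _ hlam

theorem evalHom_dispersion {d ν : ℕ} [NeZero ν] (q : Fin d → ℕ) (V : Vertex d ν → ℂ) (lam : ℂ)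
    (z : Fin d → ℂˣ) : evalHom z (dispersion q V lam) =
      ((evalHom z).mapMatrix (floquetMatrix q V) - Matrix.scalar (Cell ν q) lam).det := by
  rw [dispersion, AlgHom.map_det, map_sub]
  congr 2
  ext a b
  rw [AlgHom.mapMatrix_apply, Matrix.map_apply, Matrix.scalar_apply, Matrix.scalar_apply,
    Matrix.diagonal_apply, Matrix.diagonal_apply]
  split_ifs
  · exact (evalHom z).commutes lam
  · exact map_zero _

/-- Divisibility makes the ratios `(σ_i / ρ_i) ^ s_i` equal to a single number `c`, which is a
`q_j`-th root of unity for every `j`. Its order divides the gcd of the periods, so `c = 1`. -/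
theorem eq_of_linearForm_rootTuple_dvd {d : ℕ} (hd : 2 ≤ d) {q : Fin d → ℕ}
    (hgcd : Finset.univ.gcd q = 1) {ζ : Fin d → ℂˣ} (hζ : ∀ i, IsPrimitiveRoot (ζ i) (q i))
    {s : Fin d → ℤˣ} {m n : Box q}
    (h : linearForm (rootTuple ζ m) s ∣ linearForm (rootTuple ζ n) s) : m = n := by
  have h1 := div_zpow_eq_of_linearForm_dvd hd h
  refine rootTuple_injective hζ (funext fun i => ?_)
  obtain ⟨c, hc⟩ : ∃ c, c = (rootTuple ζ n i / rootTuple ζ m i) ^ (s i : ℤ) := ⟨_, rfl⟩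
  have h2 : ∀ j, c ^ q j = 1 := by
    intro j
    rw [hc, h1 i j, ← zpow_natCast, zpow_comm, zpow_natCast, div_pow, rootTuple_pow hζ,
      rootTuple_pow hζ, div_one, one_zpow]
  have h3 : orderOf c ∣ 1 := by
    rw [← hgcd]
    exact Finset.dvd_gcd fun j _ => orderOf_dvd_of_pow_eq_one (h2 j)
  have h4 : c = 1 := orderOf_eq_one_iff.1 (Nat.dvd_one.1 h3)
  rw [h4] at hc
  have h5 := zpow_unit_zpow_unit (rootTuple ζ n i / rootTuple ζ m i) (s i)
  rw [← hc, one_zpow, eq_comm, div_eq_one] at h5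
  exact h5.symm

theorem irreducible_dispersion {d ν : ℕ} (hd : 2 ≤ d) [NeZero ν] {q : Fin d → ℕ}
    (hq : ∀ i, 0 < q i) (hgcd : Finset.univ.gcd q = 1) (V : Vertex d ν → ℂ) {lam : ℂ}
    {y : Fin d → ℂˣ} (hy : ∑ i, (y i : ℂ) = 0)
    (hlam : evalHom (fun i => y i ^ q i) (dispersion q V lam) ≠ 0)
    (hdec : ((localMatrix q V - Matrix.scalar (Cell ν q) lam).toBlock (fun a => ¬ a.2 = 0)
      (fun a => ¬ a.2 = 0)).det ≠ 0) : Irreducible (dispersion q V lam) := by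
  choose ζ hζ using fun i => exists_isPrimitiveRoot_units (hq i)
  obtain ⟨U, hU⟩ := exists_det_onLattice_add (hopping q) _ hdec
  rw [← expand_dispersion hq] at hU
  obtain ⟨U', hU'⟩ := exists_det_hopping_add hq hζ U
  obtain ⟨c, hc⟩ : ∃ c, c = ((localMatrix q V - Matrix.scalar (Cell ν q) lam).toBlock
    (fun a => ¬ a.2 = 0) (fun a => ¬ a.2 = 0)).det := ⟨_, rfl⟩
  rw [hU', ← hc, algebraMap_laurentPoly] at hU
  rw [← hc] at hdec
  obtain ⟨n₀, hn₀⟩ : ∃ n₀ : Box q, rootTuple ζ n₀ = 1 :=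
    ⟨fun i => ⟨0, hq i⟩, funext fun i => pow_zero _⟩
  have hsign : ∀ s, IsLeadingForm (signWeight s) (Fintype.card (Box q))
      (expand q (dispersion q V lam))
      (single 0 c * ∏ n : Box q, linearForm (rootTuple ζ n) s) := by
    intro s
    rw [hU]
    exact (isLeadingForm_sign hd _ _ s).const_mul hdec
  have haxis : ∀ i ε, ∃ c, c ≠ 0 ∧ IsLeadingForm (axisWeight i ε) (Fintype.card (Box q))
      (expand q (dispersion q V lam)) (single ((Fintype.card (Box q) : ℤ) • axisWeight i ε) c) := by
    intro i ε
    refine ⟨c * ∏ n : Box q, ((rootTuple ζ n i ^ (ε : ℤ) : ℂˣ) : ℂ),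
      mul_ne_zero hdec (Finset.prod_ne_zero_iff.2 fun n _ => Units.ne_zero _), ?_⟩
    have h := (isLeadingForm_axis (fun n : Box q => rootTuple ζ n) U' i ε).const_mul hdec
    rw [← hU, prod_single, AddMonoidAlgebra.single_mul_single, zero_add, Finset.card_univ] at h
    exact h
  -- The factor with `ρ = 1` is `∑ i, x_i`, which vanishes at `y`, whereas the expanded dispersion
  -- polynomial does not.
  have htwo : ¬ single 0 c * ∏ n : Box q, linearForm (rootTuple ζ n) 1 ∣
      expand q (dispersion q V lam) := by
    rintro ⟨g, hg⟩
    have h1 := congrArg (evalHom y) hg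
    rw [map_mul, map_mul, map_prod, Finset.prod_eq_zero (Finset.mem_univ n₀), mul_zero, zero_mul,
      evalHom_expand] at h1
    · exact hlam h1
    · rw [hn₀, evalHom_linearForm]
      simpa using hy
  -- Exponents of an expanded polynomial are multiples of the periods, on which the root-of-unity
  -- characters are trivial. Leading forms inherit this.
  have hinv : ∀ (F f : LaurentPoly d) t k, IsLeadingForm t k (expand q F) f →
      ∀ n : Box q, twist (rootTuple ζ n) f = f := by
    intro F f t k h n
    refine twist_eq_self fun α hα => ?_
    have h1 : (expand q F).coeff α ≠ 0 := h.coeff_eq (h.2.1 α hα) ▸ hα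
    obtain ⟨β, rfl⟩ := expand_mem_supportedIn q F α h1
    have h2 := congrArg (fun u : ℂˣ => (u : ℂ)) (character_period_mul (rootTuple_pow hζ n) β)
    simpa [character, Units.coe_prod] using h2
  constructor
  -- A unit is a monomial, hence its own leading form for every weight, and would be divisible by
  -- that form.
  · intro hu
    have h1 := hu.map (expand q)
    obtain ⟨α, e, he, hα⟩ := isUnit_iff.1 h1
    have h2 : IsLeadingForm (signWeight 1) (signWeight 1 ⬝ᵥ α) (expand q (dispersion q V lam))
        (single α e) := by
      rw [hα]
      exact ⟨(isUnit_single α he).ne_zero, single_mem_supportedIn (by rw [Set.mem_ofPred_eq]) e, by simp⟩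
    exact htwo (((hsign 1).unique h2) ▸ (isUnit_single α he).dvd)
  · intro F G hFG
    have hmul : expand q (dispersion q V lam) = expand q F * expand q G := by rw [hFG, map_mul]
    have key := isUnit_or_isUnit_of_leadingForms (F := expand q F) (G := expand q G) hd
      (hmul ▸ haxis) (fun s => ⟨_, hmul ▸ hsign s⟩) (hmul ▸ hsign 1) ?_ fun _ => hmul ▸ htwo
    · exact key.imp (isUnit_of_isUnit_expand hq) (isUnit_of_isUnit_expand hq)
    · intro s k f l g hf hg
      refine isUnit_or_isUnit_of_mul_eq_prod_linearForm hd (fun n : Box q => rootTuple ζ n) s hn₀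
        (fun m n h => eq_of_linearForm_rootTuple_dvd hd hgcd hζ h) hdec ?_
        (hinv F f _ _ hf) (hinv G g _ _ hg)
      have h1 := hsign s
      rw [hmul] at h1
      exact (hf.mul hg).unique h1

end DecoratedLattice

/-! ### Conclusion: the finite set of exceptional energies. -/

theorem mainTheorem4 (d ν : ℕ) (hd : 2 ≤ d) [NeZero ν] (q : Fin d → ℕ) (hq : ∀ i, 0 < q i)
    (hgcd : Finset.univ.gcd q = 1) (V : DecoratedLattice.Vertex d ν → ℂ)
    (hV : DecoratedLattice.IsPeriodic q V) :
    {lam : ℂ | ¬ (Irreducible (DecoratedLattice.dispersion q V lam) ∧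
      DecoratedLattice.IsIrreducibleVariety (DecoratedLattice.fermiVariety q V lam))}.Finite := by
  obtain ⟨y, hy⟩ := DecoratedLattice.exists_units_sum_eq_zero hd
  -- The exceptional energies lie among the eigenvalues of the Floquet matrix at the single point
  -- `z_i = y_i ^ q_i` and those of the block of decorating vertices.
  refine ((DecoratedLattice.finite_setOf_det_sub_scalar_eq_zero
    ((DecoratedLattice.evalHom fun i => y i ^ q i).mapMatrix
      (DecoratedLattice.floquetMatrix q V))).union
    (DecoratedLattice.finite_setOf_det_sub_scalar_eq_zero
      ((DecoratedLattice.localMatrix q V).toBlock (fun a => ¬ a.2 = 0)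
        (fun a => ¬ a.2 = 0)))).subset fun lam hlam => ?_
  by_contra hcon
  simp only [Set.mem_union, Set.mem_ofPred_eq, not_or] at hcon
  rw [← DecoratedLattice.evalHom_dispersion] at hcon
  have hblock : (DecoratedLattice.localMatrix q V - Matrix.scalar _ lam).toBlock
      (fun a => ¬ a.2 = 0) (fun a => ¬ a.2 = 0) =
      (DecoratedLattice.localMatrix q V).toBlock (fun a => ¬ a.2 = 0) (fun a => ¬ a.2 = 0) -
        Matrix.scalar _ lam := by
    ext a b
    simp [Matrix.toBlock_apply, Matrix.diagonal_apply, Subtype.ext_iff]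
  have hirr := DecoratedLattice.irreducible_dispersion hd hq hgcd V hy hcon.1 (hblock ▸ hcon.2)
  exact hlam ⟨hirr, DecoratedLattice.isIrreducibleVariety_of_irreducible hirr⟩
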